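/- Let $d\ge 1$, let $\mathcal X\subset\mathbb R^d$ be compact, $\mathcal Y\subset\mathbb R$, and let $P$ be a probability distribution on $\mathcal X\times\mathcal Y$ with marginal $P_{\mathcal X}$ on $\mathcal X$ and a regular conditional distribution $P(\cdot\mid x)$ of the label. Write $\mathcal X^2=\mathcal X\times\mathcal X\subset\mathbb R^{2d}$, $P^2_{\mathcal X}=P_{\mathcal X}\otimes P_{\mathcal X}$, and let $\|\cdot\|_2$ and $\mathrm{dist}$ be Euclidean on $\mathbb R^{2d}$. For $(x,x')\in\mathcal X^2$ let $\eta_+(x,x')$ and $\eta_-(x,x')$ be the probabilities of $y>y'$ and of $y<y'$ when $y\sim P(\cdot\mid x)$ and $y'\sim P(\cdot\mid x')$ are independent; let $\mathcal X^2_+,\mathcal X^2_-,\mathcal X^2_=$ be the sets where $\eta_+>\eta_-$, $\eta_+<\eta_-$, $\eta_+=\eta_-$. Let $\Delta(x,x')$ be $\mathrm{dist}((x,x'),\mathcal X^2_-\cup\mathcal X^2_=)$ on $\mathcal X^2_+$, $\mathrm{dist}((x,x'),\mathcal X^2_+\cup\mathcal X^2_=)$ on $\mathcal X^2_-$, and $0$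 on $\mathcal X^2_=$. For measurable $f:\mathcal X^2\to\mathbb R$ the hinge risk is $$\mathcal R(f)=\mathbb E\max\{1-\mathrm{sgn}(Y-Y')f(X,X'),0\},\qquad (X,Y),(X',Y')\sim P\text{ i.i.d.},\quad \mathrm{sgn}(0)=0,$$ and $f^*=\mathrm{sgn}(\eta_+-\eta_-)$. For $\sigma>0$ let $\mathcal H_{K^\sigma}$, with norm $\|\cdot\|_{K^\sigma}$, be the reproducing kernel Hilbert space on $\mathcal X^2$ of the kernel $$K^\sigma((x,x'),(u,u'))=\tfrac12 e^{-\|(x,x')-(u,u')\|_2^2/\sigma^2}-\tfrac12 e^{-\|(x',x)-(u,u')\|_2^2/\sigma^2}.$$ Suppose that $\|(x,x')\|_2\le r$ for all $(x,x')\in\mathcal X^2$, where $r>0$, and that the margin-noise condition holds with constants $C_{**}>0$ and $\beta>0$: for all $t\ge0$, $$\int_{\{\Delta<t\}}|\eta_+-\eta_-|\,dP_{\mathcal X}^2\le C_{**}t^\beta .$$ Then $f^*$ is a Bayes rule for the hinge risk, i.e. it is Borel measurable and minimises $\mathcal R$ over all Borel measurable functions $\mathcal X^2\to\mathbb R$.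 Moreover, there is a Borel measurable, skew-symmetric function $F:\mathbb R^{2d}\to\{-1,0,1\}$ (that is, $F(u',u)=-F(u,u')$), vanishing outside the closed ball of radius $2r$ about $0$, such that $F=f^*$ on $\mathcal X^2$ and, for every $(x,x')\in\mathcal X^2$, $F$ is constantly equal to $f^*(x,x')$ on the open ball of radius $\Delta(x,x')/2$ about $(x,x')$, and such that for all $\lambda>0$ and $\sigma>0$ the function $$f_0(x,x')=\Big(\frac{2}{\pi\sigma^2}\Big)^{d}\int_{\mathbb R^{2d}}e^{-2\|(x,x')-(u,u')\|_2^2/\sigma^2}F(u,u')\,d(u,u'),\qquad (x,x')\in\mathcal X^2,$$ belongs to $\mathcal H_{K^\sigma}$, satisfies $\|f_0\|_\infty\le1$, and $$\lambda\|f_0\|_{K^\sigma}^2+\mathcal R(f_0)-\mathcal R(f^*)\le\frac{2^{2d+1}r^{2d}}{\Gamma(d)}\,\lambda\sigma^{-2d}+\frac{2^{\beta/2+1}C_{**}\,\Gamma(d+\frac\beta2)}{\Gamma(d)}\,\sigma^\beta .$$ -/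

import Mathlib

open MeasureTheory ProbabilityTheory
open scoped ENNReal

noncomputable section

namespace PairwiseRanking

/-- Feature vectors live in `ℝ^d` with its Euclidean norm. -/
abbrev Feat (d : ℕ) : Type := EuclideanSpace ℝ (Fin d)

/-- A pair of points of `ℝ^d` as a point of `ℝ^{2d}` with the Euclidean norm
`‖(x, x')‖₂² = ‖x‖₂² + ‖x'‖₂²` (the bare product type carries the sup norm). -/
def pt {d : ℕ} (p : Feat d × Feat d) : WithLp 2 (Feat d × Feat d) := WithLp.toLp 2 p

/-- The pair of points of `ℝ^d` underlying a pair of points of the input domain `X`. -/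
def val₂ {d : ℕ} {X : Set (Feat d)} (p : X × X) : Feat d × Feat d := (p.1, p.2)

/-! ### The pairwise Gaussian kernel and its reproducing kernel Hilbert space -/

/-- The Gaussian kernel `exp (-‖p - q‖₂² / σ²)` on `ℝ^{2d}`. -/
def gaussKer {d : ℕ} (σ : ℝ) (p q : Feat d × Feat d) : ℝ :=
  Real.exp (-(‖pt p - pt q‖ ^ 2 / σ ^ 2))

/-- The pairwise Gaussian kernel
`K^σ((x,x'),(u,u')) = ½ exp (-‖(x,x') - (u,u')‖² / σ²) - ½ exp (-‖(x',x) - (u,u')‖² / σ²)`. -/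
def pairKer {d : ℕ} (σ : ℝ) (p q : Feat d × Feat d) : ℝ :=
  1 / 2 * gaussKer σ p q - 1 / 2 * gaussKer σ p.swap q

/-- The pairwise Gaussian kernel on `X² × X²`, as an operator-valued kernel: the real number
`K^σ(p, q)` is regarded as a continuous linear map `ℝ → ℝ`. -/
def kerMat {d : ℕ} (X : Set (Feat d)) (σ : ℝ) : Matrix (X × X) (X × X) (ℝ →L[ℝ] ℝ) :=
  Matrix.of fun p q => pairKer σ (val₂ p) (val₂ q) • ContinuousLinearMap.id ℝ ℝ

theorem norm_pt_sub_sq {d : ℕ} (p q : Feat d × Feat d) :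
    ‖pt p - pt q‖ ^ 2 = ‖p.1 - q.1‖ ^ 2 + ‖p.2 - q.2‖ ^ 2 := by
  rw [WithLp.prod_norm_sq_eq_of_L2]; rfl

theorem gaussKer_comm {d : ℕ} (σ : ℝ) (p q : Feat d × Feat d) :
    gaussKer σ p q = gaussKer σ q p := by
  unfold gaussKer; rw [norm_sub_rev]

theorem gaussKer_swap {d : ℕ} (σ : ℝ) (p q : Feat d × Feat d) :
    gaussKer σ p.swap q = gaussKer σ p q.swap := by
  unfold gaussKer; simp only [norm_pt_sub_sq, Prod.fst_swap, Prod.snd_swap]; rw [add_comm]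

theorem pairKer_comm {d : ℕ} (σ : ℝ) (p q : Feat d × Feat d) :
    pairKer σ p q = pairKer σ q p := by
  unfold pairKer; rw [gaussKer_comm σ p q, gaussKer_swap, gaussKer_comm σ p q.swap]

/-- An un-normalised feature function of the Gaussian kernel. -/
def gaussFeat {d : ℕ} (σ : ℝ) (p u : Feat d × Feat d) : ℝ :=
  Real.exp (-(2 * ‖pt p - pt u‖ ^ 2 / σ ^ 2))

theorem integrable_gauss {d : ℕ} {a : ℝ} (ha : 0 < a) :
    Integrable (fun u : Feat d × Feat d => Real.exp (-(a * ‖pt u‖ ^ 2))) := by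
  have h := GaussianFourier.integrable_cexp_neg_mul_sq_norm_add (V := Feat d) (b := (a : ℂ))
    (by simpa using ha) 0 0
  have h1 : Integrable (fun v : Feat d => Real.exp (-(a * ‖v‖ ^ 2))) := by
    refine h.norm.congr (Filter.Eventually.of_forall fun v => ?_)
    simp only [Complex.norm_exp]
    norm_cast
    simp
  refine (h1.mul_prod h1).congr (Filter.Eventually.of_forall fun u => ?_)
  have : ‖pt u‖ ^ 2 = ‖u.1‖ ^ 2 + ‖u.2‖ ^ 2 := by rw [WithLp.prod_norm_sq_eq_of_L2]; rfl
  simp only [this, ← Real.exp_add]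
  ring_nf

theorem gaussFeat_mul {d : ℕ} (σ : ℝ) (p q u : Feat d × Feat d) :
    gaussFeat σ p u * gaussFeat σ q u =
      gaussKer σ p q * Real.exp (-(4 / σ ^ 2 * ‖pt (u - (1 / 2 : ℝ) • (p + q))‖ ^ 2)) := by
  unfold gaussFeat gaussKer
  rw [← Real.exp_add, ← Real.exp_add]
  congr 1
  have e : pt (u - (1 / 2 : ℝ) • (p + q)) = - (1 / 2 : ℝ) • ((pt p - pt u) + (pt q - pt u)) := by
    unfold pt
    rw [← WithLp.toLp_sub, ← WithLp.toLp_sub, ← WithLp.toLp_add, ← WithLp.toLp_smul]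
    congr 1
    module
  have e2 : pt p - pt q = (pt p - pt u) - (pt q - pt u) := by abel
  have par := parallelogram_law_with_norm ℝ (pt p - pt u) (pt q - pt u)
  rw [e, norm_smul, e2]
  simp only [norm_neg, norm_div, norm_one, Real.norm_ofNat]
  have : ‖pt p - pt u - (pt q - pt u)‖ ^ 2 = 2 * (‖pt p - pt u‖ ^ 2 + ‖pt q - pt u‖ ^ 2)
    - ‖pt p - pt u + (pt q - pt u)‖ ^ 2 := by nlinarith [par]
  rw [this]
  ring

theorem volume_pair_invariant (d : ℕ) :
    (volume : Measure (Feat d × Feat d)).IsAddRightInvariant :=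
  inferInstanceAs (((volume : Measure (Feat d)).prod volume).IsAddRightInvariant)

theorem integrable_gaussFeat_mul {d : ℕ} {σ : ℝ} (hσ : σ ≠ 0) (p q : Feat d × Feat d) :
    Integrable (fun u => gaussFeat σ p u * gaussFeat σ q u) := by
  have := volume_pair_invariant d
  have h4 : 0 < 4 / σ ^ 2 := by positivity
  simp only [gaussFeat_mul]
  exact ((integrable_gauss h4).comp_sub_right ((1 / 2 : ℝ) • (p + q))).const_mul _

theorem integral_gaussFeat_mul {d : ℕ} (σ : ℝ) (p q : Feat d × Feat d) :
    ∫ u, gaussFeat σ p u * gaussFeat σ q u =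
      gaussKer σ p q * ∫ u : Feat d × Feat d, Real.exp (-(4 / σ ^ 2 * ‖pt u‖ ^ 2)) := by
  simp only [gaussFeat_mul]
  rw [integral_const_mul]
  congr 1
  have := volume_pair_invariant d
  exact integral_sub_right_eq_self
    (fun u : Feat d × Feat d => Real.exp (-(4 / σ ^ 2 * ‖pt u‖ ^ 2))) ((1 / 2 : ℝ) • (p + q))

/-- The pairwise Gaussian kernel is positive semi-definite. -/
theorem pairKer_psd {d : ℕ} (σ : ℝ) {ι : Type*} (s : Finset ι) (c : ι → ℝ)
    (z : ι → Feat d × Feat d) :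
    0 ≤ ∑ i ∈ s, ∑ j ∈ s, c i * c j * pairKer σ (z i) (z j) := by
  rcases eq_or_ne σ 0 with rfl | hσ
  · simp [pairKer, gaussKer]
  set A : ℝ := ∫ u : Feat d × Feat d, Real.exp (-(4 / σ ^ 2 * ‖pt u‖ ^ 2)) with hA
  have hApos : 0 < A := by
    refine integral_exp_pos (integrable_gauss (by positivity))
  let ψ : Feat d × Feat d → Feat d × Feat d → ℝ :=
    fun p u => 1 / 2 * (gaussFeat σ p u - gaussFeat σ p.swap u)
  have hexp : ∀ p q u, ψ p u * ψ q u = 1 / 4 * ((gaussFeat σ p u * gaussFeat σ q u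
      - gaussFeat σ p u * gaussFeat σ q.swap u)
      - (gaussFeat σ p.swap u * gaussFeat σ q u - gaussFeat σ p.swap u * gaussFeat σ q.swap u)) := by
    intro p q u; simp only [ψ]; ring
  have hint : ∀ p q, Integrable (fun u => ψ p u * ψ q u) := by
    intro p q
    simp only [hexp]
    exact (((integrable_gaussFeat_mul hσ _ _).sub (integrable_gaussFeat_mul hσ _ _)).sub
      ((integrable_gaussFeat_mul hσ _ _).sub (integrable_gaussFeat_mul hσ _ _))).const_mul _
  have hval : ∀ p q, ∫ u, ψ p u * ψ q u = A * pairKer σ p q := by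
    intro p q
    have i := fun p q : Feat d × Feat d => integrable_gaussFeat_mul hσ p q
    simp only [hexp]
    rw [integral_const_mul]
    erw [integral_sub ((i p q).sub (i p q.swap)) ((i p.swap q).sub (i p.swap q.swap))]
    erw [integral_sub (i p q) (i p q.swap), integral_sub (i p.swap q) (i p.swap q.swap)]
    simp only [integral_gaussFeat_mul, ← hA, pairKer, gaussKer_swap, Prod.swap_swap]
    ring
  have key : A * ∑ i ∈ s, ∑ j ∈ s, c i * c j * pairKer σ (z i) (z j)
      = ∫ u, (∑ i ∈ s, c i * ψ (z i) u) ^ 2 := by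
    have : ∀ u, (∑ i ∈ s, c i * ψ (z i) u) ^ 2
        = ∑ i ∈ s, ∑ j ∈ s, c i * c j * (ψ (z i) u * ψ (z j) u) := by
      intro u
      rw [sq, Finset.sum_mul_sum]
      exact Finset.sum_congr rfl fun i _ => Finset.sum_congr rfl fun j _ => by ring
    simp only [this]
    rw [integral_finsetSum _ fun i _ => integrable_finsetSum _ fun j _ => (hint _ _).const_mul _,
      Finset.mul_sum]
    refine Finset.sum_congr rfl fun i _ => ?_
    rw [integral_finsetSum _ fun j _ => (hint _ _).const_mul _, Finset.mul_sum]
    refine Finset.sum_congr rfl fun j _ => ?_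
    rw [integral_const_mul, hval]
    ring
  have h0 : 0 ≤ A * ∑ i ∈ s, ∑ j ∈ s, c i * c j * pairKer σ (z i) (z j) := by
    rw [key]; exact integral_nonneg fun u => sq_nonneg _
  exact nonneg_of_mul_nonneg_right h0 hApos

theorem kerMat_posSemidef {d : ℕ} (X : Set (Feat d)) (σ : ℝ) : (kerMat X σ).PosSemidef := by
  have h0 := (RKHS.posSemidef_tfae (K := kerMat X σ)).out 0 2
  rw [h0]
  refine ⟨?_, fun vv => ?_⟩
  · ext p q
    simp [kerMat, pairKer_comm σ (val₂ p) (val₂ q), ContinuousLinearMap.star_eq_adjoint,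
      ContinuousLinearMap.adjoint_id]
  · have h := pairKer_psd σ vv.support (fun p => vv p) (fun p => val₂ p)
    refine h.trans_eq ?_
    simp only [Finsupp.sum, kerMat, Matrix.of_apply]
    refine Finset.sum_congr rfl fun p _ => Finset.sum_congr rfl fun q _ => ?_
    simp [pairKer_comm σ (val₂ p) (val₂ q)]
    ring

instance kerMat_fact {d : ℕ} (X : Set (Feat d)) (σ : ℝ) : Fact (kerMat X σ).PosSemidef :=
  ⟨kerMat_posSemidef X σ⟩

/-- The reproducing kernel Hilbert space `H_{K^σ}` of the pairwise Gaussian kernel on `X²`: the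
completion of the span of the kernel functions. Its elements coerce to functions `X × X → ℝ`. -/
abbrev GaussRKHS {d : ℕ} (X : Set (Feat d)) (σ : ℝ) : Type := RKHS.OfKernel (kerMat X σ)

/-! ### Posterior probabilities, Bayes rule, distance to the decision boundary -/

section Posterior

variable {d : ℕ} {X : Set (Feat d)} {Y : Set ℝ}

/-- `η₊(x, x') = P(y > y' | x, x')`, where `κ x` is the conditional law `P(· | x)` of the label and
the two labels are drawn independently. -/
def etaPos (κ : Kernel X Y) (p : X × X) : ℝ :=
  ((κ p.1).prod (κ p.2)).real {q | (q.2 : ℝ) < (q.1 : ℝ)}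

/-- `η₋(x, x') = P(y < y' | x, x')`. -/
def etaNeg (κ : Kernel X Y) (p : X × X) : ℝ :=
  ((κ p.1).prod (κ p.2)).real {q | (q.1 : ℝ) < (q.2 : ℝ)}

/-- `X²₊`. -/
def posSet (κ : Kernel X Y) : Set (X × X) := {p | etaNeg κ p < etaPos κ p}

/-- `X²₋`. -/
def negSet (κ : Kernel X Y) : Set (X × X) := {p | etaPos κ p < etaNeg κ p}

/-- `X²₌`. -/
def eqSet (κ : Kernel X Y) : Set (X × X) := {p | etaPos κ p = etaNeg κ p}

/-- The Bayes ranking rule `f*_hinge(x, x') = sgn (η₊(x, x') - η₋(x, x'))`. -/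
def bayesRule (κ : Kernel X Y) (p : X × X) : ℝ := Real.sign (etaPos κ p - etaNeg κ p)

/-- The Euclidean distance in `ℝ^{2d}` of a point of `X²` to a subset of `X²`. -/
def distTo (p : X × X) (A : Set (X × X)) : ℝ :=
  Metric.infDist (pt (val₂ p)) ((fun q => pt (val₂ q)) '' A)

open Classical in
/-- The distance `Δ` to the decision boundary. (The sets to which distances are taken contain the
diagonal of `X²`, as `η₊ = η₋` there, so they are not empty.) -/
def boundaryDist (κ : Kernel X Y) (p : X × X) : ℝ :=
  if p ∈ posSet κ then distTo p (negSet κ ∪ eqSet κ)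
  else if p ∈ negSet κ then distTo p (posSet κ ∪ eqSet κ)
  else 0

/-- The margin-noise condition with constant `C` and exponent `β`. -/
def MarginNoise (P : Measure (X × Y)) (κ : Kernel X Y) (C β : ℝ) : Prop :=
  ∀ t : ℝ, 0 ≤ t →
    ∫ p in {p | boundaryDist κ p < t}, |etaPos κ p - etaNeg κ p| ∂(P.fst.prod P.fst) ≤ C * t ^ β

end Posterior

/-! ### The hinge risk -/

/-- The hinge ranking loss `max {1 - sgn (y - y') t, 0}`. -/
def hingeLoss (y y' t : ℝ) : ℝ := max (1 - Real.sign (y - y') * t) 0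

/-- The hinge risk `E φ_hinge(Y, Y', f(X, X'))`, for two independent draws from `P`, as a number in
`[0, ∞]`. -/
def hingeRisk {d : ℕ} {X : Set (Feat d)} {Y : Set ℝ} (P : Measure (X × Y)) (f : X × X → ℝ) :
    ℝ≥0∞ :=
  ∫⁻ z : (X × Y) × (X × Y),
    ENNReal.ofReal (hingeLoss z.1.2 z.2.2 (f (z.1.1, z.2.1))) ∂(P.prod P)

/-- `f` is a Borel measurable minimiser of the hinge risk over all Borel measurable functions. -/
def IsHingeBayes {d : ℕ} {X : Set (Feat d)} {Y : Set ℝ} (P : Measure (X × Y)) (f : X × X → ℝ) :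
    Prop :=
  Measurable f ∧ ∀ g : X × X → ℝ, Measurable g → hingeRisk P f ≤ hingeRisk P g

/-! ### Gaussian convolution of an extension of the Bayes rule -/

/-- `F : ℝ^{2d} → {-1, 0, 1}` is a margin-preserving extension of the Bayes rule, supported in the
closed ball of radius `2r`: it is Borel measurable, skew-symmetric, agrees with the Bayes rule on
`X²`, and around each point `p` of `X²` it keeps the value of the Bayes rule at `p` on the open ball
whose radius is half the distance of `p` to the decision boundary. -/
structure IsMarginExtension {d : ℕ} {X : Set (Feat d)} {Y : Set ℝ} (κ : Kernel X Y) (r : ℝ)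
    (F : Feat d × Feat d → ℝ) : Prop where
  measurable : Measurable F
  values : ∀ w, F w = -1 ∨ F w = 0 ∨ F w = 1
  skew : ∀ w, F w.swap = -F w
  support : ∀ w, 2 * r < ‖pt w‖ → F w = 0
  extends_bayes : ∀ p : X × X, F (val₂ p) = bayesRule κ p
  margin : ∀ (p : X × X) (w : Feat d × Feat d),
    dist (pt w) (pt (val₂ p)) < boundaryDist κ p / 2 → F w = bayesRule κ p

/-- The convolution of `F` with the Gaussian probability density
`(2 / (π σ²))^d exp (-2 ‖·‖² / σ²)` on `ℝ^{2d}`. -/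
def gaussConv {d : ℕ} (σ : ℝ) (F : Feat d × Feat d → ℝ) (p : Feat d × Feat d) : ℝ :=
  (2 / (Real.pi * σ ^ 2)) ^ d *
    ∫ w : Feat d × Feat d, Real.exp (-(2 * ‖pt p - pt w‖ ^ 2 / σ ^ 2)) * F w

end PairwiseRanking

end

/-! Bayes rule. Given the features, the hinge risk of a prediction `t` is `1 + ((1-t)₊ - 1) η₊ +
((1+t)₊ - 1) η₋`, and `sgn (η₊ - η₋)` minimises it pointwise. Disintegrating two independent draws
(`hingeRisk_eq`) turns this into minimality of the risk. For `|f| ≤ 1` the conditional risk is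
affine in `f`, so the excess risk equals `∫ (η₊ - η₋)(f* - f)`.

Extension. `F` is `1` on `X²₊` and on the half-margin balls around its points, and `-1` likewise for
`X²₋`. If `p` and `q` lie in the two classes, both margins are at most their distance, so the two
hulls are disjoint (`disjoint_marginHull`). Swapping coordinates is an isometry exchanging the
classes, hence `F` is skew. The diagonal lies in `X²₌`, hence `Δ ≤ 2r` and `F` vanishes outside the
ball of radius `2r`.

RKHS norm. The functions `pairFeat σ p` are, up to a constant, an `L²` feature map of the kernel,
and skewness of `F` makes `f₀(p)` a multiple of `∫ pairFeat σ p * F`. By Cauchy–Schwarz and Riesz,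
`f₀` lies in the RKHS with squared norm at most a constant times the volume of the ball of radius
`2r` (`exists_gaussRKHS_eq_gaussConv`).

Excess risk. `f₀(p)` is the mean of `F(p + v)` for Gaussian `v`, and `F(p + v) = f*(p)` unless `Δ(p)
≤ 2‖v‖`. Fubini and the margin-noise condition at level `2‖v‖` bound the excess by `2C E(2‖v‖)^β`, a
Gaussian moment (`IsMarginExtension.toReal_hingeRisk_sub_le`). -/

namespace PairwiseRanking

/-! ### Gaussian integrals, ball volumes and the Gaussian law on `ℝ^{2d}`. -/

theorem pt_sub {d : ℕ} (p q : Feat d × Feat d) : pt (p - q) = pt p - pt q := rfl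

theorem norm_pt_neg {d : ℕ} (p : Feat d × Feat d) : ‖pt (-p)‖ = ‖pt p‖ := norm_neg (pt p)

theorem continuous_pt {d : ℕ} : Continuous (pt (d := d)) :=
  WithLp.prod_continuous_toLp 2 _ _

theorem finrank_withLp_prod_feat (d : ℕ) :
    Module.finrank ℝ (WithLp 2 (Feat d × Feat d)) = 2 * d := by
  rw [(WithLp.linearEquiv 2 ℝ (Feat d × Feat d)).finrank_eq, Module.finrank_prod,
    finrank_euclideanSpace_fin]
  ring

theorem measurePreserving_pt (d : ℕ) : MeasurePreserving (pt (d := d)) :=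
  WithLp.volume_preserving_toLp _ _

theorem measurableEmbedding_pt (d : ℕ) : MeasurableEmbedding (pt (d := d)) :=
  (WithLp.homeomorphProd 2 (Feat d) (Feat d)).symm.measurableEmbedding

theorem integral_comp_pt {d : ℕ} (g : WithLp 2 (Feat d × Feat d) → ℝ) :
    ∫ u : Feat d × Feat d, g (pt u) = ∫ w, g w :=
  (measurePreserving_pt d).integral_comp (measurableEmbedding_pt d) g

theorem integral_gauss {d : ℕ} {a : ℝ} (ha : 0 < a) :
    ∫ u : Feat d × Feat d, Real.exp (-(a * ‖pt u‖ ^ 2)) = (Real.pi / a) ^ d := by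
  rw [integral_comp_pt (fun w => Real.exp (-(a * ‖w‖ ^ 2)))]
  have h := GaussianFourier.integral_rexp_neg_mul_sq_norm (V := WithLp 2 (Feat d × Feat d)) ha
  simp only [neg_mul] at h
  rw [h, finrank_withLp_prod_feat]
  push_cast
  rw [mul_div_cancel_left₀ _ two_ne_zero, Real.rpow_natCast]

theorem volumeReal_ball {d : ℕ} (hd : 0 < d) {R : ℝ} (hR : 0 ≤ R) :
    volume.real (Metric.ball (0 : WithLp 2 (Feat d × Feat d)) R)
      = R ^ (2 * d) * (Real.pi ^ d / Real.Gamma (d + 1)) := by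
  have : Nontrivial (WithLp 2 (Feat d × Feat d)) := by
    apply Module.nontrivial_of_finrank_pos (R := ℝ)
    rw [finrank_withLp_prod_feat]; omega
  rw [measureReal_def, InnerProductSpace.volume_ball, finrank_withLp_prod_feat]
  have h : √Real.pi ^ (2 * d) = Real.pi ^ d := by
    rw [pow_mul, Real.sq_sqrt Real.pi_pos.le]
  rw [h, ENNReal.toReal_mul, ENNReal.toReal_pow, ENNReal.toReal_ofReal hR, ENNReal.toReal_ofReal]
  · push_cast
    rw [mul_div_cancel_left₀ _ two_ne_zero]
  · positivity

/-- Polar coordinates in dimension `2d` reduce this to a one-dimensional Gamma integral; the surface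
factor is `2d` times the volume of the unit ball. -/
theorem integral_norm_rpow_mul_gauss {d : ℕ} (hd : 0 < d) {a β : ℝ} (ha : 0 < a) (hβ : 0 < β) :
    ∫ u : Feat d × Feat d, ‖pt u‖ ^ β * Real.exp (-(a * ‖pt u‖ ^ 2))
      = (Real.pi / a) ^ d * a ^ (-(β / 2)) * (Real.Gamma (d + β / 2) / Real.Gamma d) := by
  have : Nontrivial (WithLp 2 (Feat d × Feat d)) := by
    apply Module.nontrivial_of_finrank_pos (R := ℝ)
    rw [finrank_withLp_prod_feat]; omega
  have hd' : (0 : ℝ) < d := by exact_mod_cast hd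
  have hG : Real.Gamma d ≠ 0 := (Real.Gamma_pos_of_pos hd').ne'
  rw [integral_comp_pt (fun w => ‖w‖ ^ β * Real.exp (-(a * ‖w‖ ^ 2))),
    integral_fun_norm_addHaar volume (fun y => y ^ β * Real.exp (-(a * y ^ 2))),
    finrank_withLp_prod_feat]
  have hI : ∫ y in Set.Ioi (0 : ℝ), y ^ (2 * d - 1) • (y ^ β * Real.exp (-(a * y ^ 2)))
      = a ^ (-((2 * d - 1 + β) + 1) / 2 : ℝ) * (1 / 2) *
        Real.Gamma (((2 * d - 1 + β) + 1) / 2) := by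
    have := integral_rpow_mul_exp_neg_mul_rpow (p := 2) (q := 2 * d - 1 + β) (b := a)
      two_pos (by linarith) ha
    rw [← this]
    refine setIntegral_congr_fun measurableSet_Ioi fun y hy => ?_
    have hy : 0 < y := hy
    have e : y ^ (2 * (d : ℝ) - 1 + β) = y ^ (2 * d - 1) * y ^ β := by
      rw [Real.rpow_add hy, ← Real.rpow_natCast y (2 * d - 1)]
      congr 2
      -- The truncated subtraction `2 * d - 1` is the true one because `d > 0`.
      rw [Nat.cast_sub (by omega)]; push_cast; ring
    simp only [smul_eq_mul]
    rw [e, Real.rpow_two, neg_mul, mul_assoc]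
  have e1 : (-((2 * d - 1 + β) + 1) / 2 : ℝ) = -d + -(β / 2) := by ring
  have e2 : ((2 * d - 1 + β) + 1) / 2 = d + β / 2 := by ring
  rw [hI, volumeReal_ball hd zero_le_one, Real.Gamma_add_one hd'.ne', e1, e2, Real.rpow_add ha,
    Real.rpow_neg ha.le, Real.rpow_natCast, one_pow, nsmul_eq_mul, smul_eq_mul, div_pow]
  push_cast
  field_simp

theorem volumeReal_norm_pt_le {d : ℕ} (hd : 0 < d) {R : ℝ} (hR : 0 ≤ R) :
    volume.real {u : Feat d × Feat d | ‖pt u‖ ≤ R}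
      = R ^ (2 * d) * (Real.pi ^ d / Real.Gamma (d + 1)) := by
  have : Nontrivial (WithLp 2 (Feat d × Feat d)) := by
    apply Module.nontrivial_of_finrank_pos (R := ℝ)
    rw [finrank_withLp_prod_feat]; omega
  rw [← volumeReal_ball hd hR, measureReal_def, measureReal_def,
    ← Measure.addHaar_closedBall_eq_addHaar_ball,
    ← (measurePreserving_pt d).measure_preimage Metric.isClosed_closedBall.nullMeasurableSet]
  congr 2
  ext u
  simp

theorem integrable_norm_rpow_mul_gauss {d : ℕ} (hd : 0 < d) {a β : ℝ} (ha : 0 < a) (hβ : 0 < β) :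
    Integrable fun u : Feat d × Feat d => ‖pt u‖ ^ β * Real.exp (-(a * ‖pt u‖ ^ 2)) := by
  have hd' : (0 : ℝ) < d := by exact_mod_cast hd
  -- A non-integrable function has Bochner integral `0`, so the positive value already computed
  -- gives integrability.
  refine Integrable.of_integral_ne_zero ?_
  rw [integral_norm_rpow_mul_gauss hd ha hβ]
  have := Real.Gamma_pos_of_pos hd'
  have := Real.Gamma_pos_of_pos (by positivity : 0 < (d : ℝ) + β / 2)
  have := Real.pi_pos
  positivity

/-- The density of the centred Gaussian law on `ℝ^{2d}` with covariance `σ² / 4`. -/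
noncomputable def gaussDens {d : ℕ} (σ : ℝ) (v : Feat d × Feat d) : ℝ :=
  (2 / (Real.pi * σ ^ 2)) ^ d * Real.exp (-(2 / σ ^ 2 * ‖pt v‖ ^ 2))

theorem gaussDens_nonneg {d : ℕ} (σ : ℝ) (v : Feat d × Feat d) : 0 ≤ gaussDens σ v := by
  have := Real.pi_pos
  unfold gaussDens; positivity

theorem continuous_gaussDens {d : ℕ} (σ : ℝ) : Continuous (gaussDens (d := d) σ) := by
  have := continuous_pt (d := d)
  unfold gaussDens; fun_prop

theorem integrable_gaussDens {d : ℕ} {σ : ℝ} (hσ : 0 < σ) : Integrable (gaussDens (d := d) σ) :=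
  (integrable_gauss (by positivity)).const_mul _

theorem integral_gaussDens {d : ℕ} {σ : ℝ} (hσ : 0 < σ) : ∫ v, gaussDens (d := d) σ v = 1 := by
  have := Real.pi_pos
  unfold gaussDens
  rw [integral_const_mul, integral_gauss (by positivity), ← mul_pow]
  field_simp
  simp

/-- The centred Gaussian law on `ℝ^{2d}` with covariance `σ² / 4`. -/
noncomputable def gaussLaw (d : ℕ) (σ : ℝ) : Measure (Feat d × Feat d) :=
  volume.withDensity fun v => ENNReal.ofReal (gaussDens σ v)

theorem isProbabilityMeasure_gaussLaw {d : ℕ} {σ : ℝ} (hσ : 0 < σ) :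
    IsProbabilityMeasure (gaussLaw d σ) := by
  refine ⟨?_⟩
  rw [gaussLaw, withDensity_apply _ MeasurableSet.univ, Measure.restrict_univ, ← ofReal_integral_eq_lintegral_ofReal (integrable_gaussDens hσ)
    (Filter.Eventually.of_forall (gaussDens_nonneg σ)), integral_gaussDens hσ, ENNReal.ofReal_one]

theorem integral_gaussLaw {d : ℕ} (σ : ℝ) (g : Feat d × Feat d → ℝ) :
    ∫ v, g v ∂(gaussLaw d σ) = ∫ v, gaussDens σ v * g v := by
  have hm := (continuous_gaussDens (d := d) σ).measurable
  rw [gaussLaw, integral_withDensity_eq_integral_toReal_smul hm.ennreal_ofReal (by simp)]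
  simp only [ENNReal.toReal_ofReal (gaussDens_nonneg σ _), smul_eq_mul]

theorem integrable_gaussLaw {d : ℕ} (σ : ℝ) (g : Feat d × Feat d → ℝ) :
    Integrable g (gaussLaw d σ) ↔ Integrable fun v => gaussDens σ v * g v := by
  have hm := (continuous_gaussDens (d := d) σ).measurable
  rw [gaussLaw, integrable_withDensity_iff_integrable_smul' hm.ennreal_ofReal (by simp)]
  simp only [ENNReal.toReal_ofReal (gaussDens_nonneg σ _), smul_eq_mul]

theorem integral_norm_rpow_gaussLaw {d : ℕ} (hd : 0 < d) {σ β : ℝ} (hσ : 0 < σ) (hβ : 0 < β) :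
    ∫ v, ‖pt v‖ ^ β ∂(gaussLaw d σ)
      = 2 ^ (-(β / 2)) * σ ^ β * (Real.Gamma (d + β / 2) / Real.Gamma d) := by
  have := Real.pi_pos
  rw [integral_gaussLaw]
  simp only [gaussDens, mul_assoc, mul_comm (Real.exp _)]
  rw [integral_const_mul, integral_norm_rpow_mul_gauss hd (by positivity) hβ, ← mul_assoc,
    ← mul_assoc, ← mul_pow]
  have e : (2 / (Real.pi * σ ^ 2)) * (Real.pi / (2 / σ ^ 2)) = 1 := by field_simp
  have e2 : (2 / σ ^ 2) ^ (-(β / 2)) = 2 ^ (-(β / 2)) * σ ^ β := by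
    rw [Real.div_rpow zero_le_two (by positivity), div_eq_mul_inv, ← Real.rpow_neg (by positivity),
      ← Real.rpow_natCast, ← Real.rpow_mul hσ.le]
    congr 2
    push_cast; ring
  rw [e, e2, one_pow]
  ring

theorem integrable_norm_rpow_gaussLaw {d : ℕ} (hd : 0 < d) {σ β : ℝ} (hσ : 0 < σ) (hβ : 0 < β) :
    Integrable (fun v => ‖pt v‖ ^ β) (gaussLaw d σ) := by
  rw [integrable_gaussLaw]
  refine ((integrable_norm_rpow_mul_gauss hd (a := 2 / σ ^ 2) (by positivity) hβ).const_mul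
    ((2 / (Real.pi * σ ^ 2)) ^ d)).congr (Filter.Eventually.of_forall fun v => ?_)
  simp only [gaussDens]; ring

theorem gaussConv_eq_integral_gaussLaw {d : ℕ} (σ : ℝ) (F : Feat d × Feat d → ℝ)
    (p : Feat d × Feat d) : gaussConv σ F p = ∫ v, F (p + v) ∂(gaussLaw d σ) := by
  have : (volume : Measure (Feat d × Feat d)).IsAddLeftInvariant :=
    inferInstanceAs (((volume : Measure (Feat d)).prod volume).IsAddLeftInvariant)
  rw [integral_gaussLaw, gaussConv, ← integral_const_mul,
    ← integral_add_left_eq_self _ p]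
  refine integral_congr_ae (Filter.Eventually.of_forall fun v => ?_)
  simp only [gaussDens, ← pt_sub, sub_add_cancel_left, norm_pt_neg]
  ring_nf

end PairwiseRanking

/-! ### Membership and norm bounds in the RKHS of the pairwise Gaussian kernel. -/

/-- A function whose finite combinations are bounded by the norms of the corresponding
combinations of kernel functions belongs to the reproducing kernel Hilbert space. -/
theorem RKHS.exists_of_forall_finsupp_bound {Z H : Type*} [NormedAddCommGroup H]
    [InnerProductSpace ℝ H] [CompleteSpace H] [RKHS ℝ H Z ℝ] (f : Z → ℝ) {M : ℝ} (hM : 0 ≤ M)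
    (h : ∀ c : Z →₀ ℝ, |c.sum fun z t => t * f z| ≤
      M * ‖c.sum fun z t => t • RKHS.kerFun H z (1 : ℝ)‖) :
    ∃ g : H, (∀ z, g z = f z) ∧ ‖g‖ ≤ M := by
  set e : (Z →₀ ℝ) →ₗ[ℝ] H := Finsupp.linearCombination ℝ fun z => RKHS.kerFun H z (1 : ℝ) with he
  set φ : (Z →₀ ℝ) →ₗ[ℝ] ℝ := Finsupp.linearCombination ℝ f with hφ
  have hdense : DenseRange e := by
    have hr : (LinearMap.range e : Submodule ℝ H) =
        Submodule.span ℝ {RKHS.kerFun H x v | (x : Z) (v : ℝ)} := by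
      rw [he, Finsupp.range_linearCombination]
      refine le_antisymm (Submodule.span_mono ?_) (Submodule.span_le.2 ?_)
      · rintro _ ⟨z, rfl⟩; exact ⟨z, 1, rfl⟩
      · rintro _ ⟨z, v, rfl⟩
        have : RKHS.kerFun H z v = v • RKHS.kerFun H z (1 : ℝ) := by
          rw [← map_smul, smul_eq_mul, mul_one]
        rw [this]
        exact Submodule.smul_mem _ _ (Submodule.subset_span ⟨z, rfl⟩)
    have hd := RKHS.kerFun_dense H
    rw [← hr] at hd
    have := (Submodule.dense_iff_topologicalClosure_eq_top (s := LinearMap.range e)).2 hd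
    exact this
  have hb : ∀ c, ‖φ c‖ ≤ M * ‖e c‖ := h
  -- By the bound, `φ` factors through `e`, whose range is dense, and so extends to `H` with norm at
  -- most `M`. The Riesz representer of the extension is the required element.
  let ψ : H →L[ℝ] ℝ := φ.extendOfNorm e
  refine ⟨(InnerProductSpace.toDual ℝ H).symm ψ, fun z => ?_, ?_⟩
  · have h1 : ψ (RKHS.kerFun H z (1 : ℝ)) = f z := by
      have := LinearMap.extendOfNorm_eq hdense ⟨M, hb⟩ (Finsupp.single z (1 : ℝ))
      simpa [he, hφ] using this
    have h2 := InnerProductSpace.toDual_symm_apply (𝕜 := ℝ) (x := RKHS.kerFun H z (1 : ℝ)) (y := ψ)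
    rw [h1, RKHS.inner_kerFun] at h2
    simpa using h2
  · rw [LinearIsometryEquiv.norm_map]
    exact LinearMap.opNorm_extendOfNorm_le hdense hM hb

/-- The Cauchy–Schwarz inequality for integrals of real functions. -/
theorem MeasureTheory.sq_integral_mul_le {Ω : Type*} [MeasurableSpace Ω] {μ : Measure Ω}
    {f g : Ω → ℝ} (hf : Integrable (fun x => f x ^ 2) μ) (hg : Integrable (fun x => g x ^ 2) μ)
    (hfg : Integrable (fun x => f x * g x) μ) :
    (∫ x, f x * g x ∂μ) ^ 2 ≤ (∫ x, f x ^ 2 ∂μ) * ∫ x, g x ^ 2 ∂μ := by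
  -- This quadratic in `t` is `∫ (t f + g)²`, so its discriminant is nonpositive.
  have h : ∀ t : ℝ, 0 ≤ (∫ x, f x ^ 2 ∂μ) * (t * t) + (2 * ∫ x, f x * g x ∂μ) * t
      + ∫ x, g x ^ 2 ∂μ := by
    intro t
    have e : (∫ x, f x ^ 2 ∂μ) * (t * t) + (2 * ∫ x, f x * g x ∂μ) * t + ∫ x, g x ^ 2 ∂μ
        = ∫ x, (t * f x + g x) ^ 2 ∂μ := by
      rw [← integral_const_mul, ← integral_mul_const, ← integral_mul_const,
        ← integral_add (hf.mul_const _) ((hfg.const_mul _).mul_const _), ← integral_add _ hg]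
      · exact integral_congr_ae (Filter.Eventually.of_forall fun x => by ring)
      · exact (hf.mul_const _).add ((hfg.const_mul _).mul_const _)
    rw [e]
    exact integral_nonneg fun x => sq_nonneg _
  have := discrim_le_zero h
  rw [discrim] at this
  linarith

namespace PairwiseRanking

/-- A feature function of the pairwise Gaussian kernel. -/
noncomputable def pairFeat {d : ℕ} (σ : ℝ) (p u : Feat d × Feat d) : ℝ :=
  1 / 2 * (gaussFeat σ p u - gaussFeat σ p.swap u)

theorem pairFeat_mul {d : ℕ} (σ : ℝ) (p q u : Feat d × Feat d) :
    pairFeat σ p u * pairFeat σ q u = 1 / 4 * ((gaussFeat σ p u * gaussFeat σ q u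
      - gaussFeat σ p u * gaussFeat σ q.swap u)
      - (gaussFeat σ p.swap u * gaussFeat σ q u - gaussFeat σ p.swap u * gaussFeat σ q.swap u)) := by
  unfold pairFeat; ring

theorem integrable_pairFeat_mul {d : ℕ} {σ : ℝ} (hσ : 0 < σ) (p q : Feat d × Feat d) :
    Integrable (fun u => pairFeat σ p u * pairFeat σ q u) := by
  have i := fun p q : Feat d × Feat d => integrable_gaussFeat_mul hσ.ne' p q
  simp only [pairFeat_mul]
  exact (((i _ _).sub (i _ _)).sub ((i _ _).sub (i _ _))).const_mul _

/-- The feature-map identity for the kernel. Swapping both arguments preserves the Gaussian kernel,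
so the four cross terms agree in pairs and the factor `1/4` becomes the `1/2` of `pairKer`. -/
theorem integral_pairFeat_mul {d : ℕ} {σ : ℝ} (hσ : 0 < σ) (p q : Feat d × Feat d) :
    ∫ u, pairFeat σ p u * pairFeat σ q u = (Real.pi / (4 / σ ^ 2)) ^ d * pairKer σ p q := by
  have i := fun p q : Feat d × Feat d => integrable_gaussFeat_mul hσ.ne' p q
  simp only [pairFeat_mul]
  rw [integral_const_mul]
  erw [integral_sub ((i p q).sub (i p q.swap)) ((i p.swap q).sub (i p.swap q.swap))]
  erw [integral_sub (i p q) (i p q.swap), integral_sub (i p.swap q) (i p.swap q.swap)]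
  simp only [integral_gaussFeat_mul, integral_gauss (d := d) (a := 4 / σ ^ 2) (by positivity),
    pairKer, gaussKer_swap, Prod.swap_swap]
  ring

theorem integrable_gaussFeat {d : ℕ} {σ : ℝ} (hσ : 0 < σ) (p : Feat d × Feat d) :
    Integrable (gaussFeat σ p) := by
  have := volume_pair_invariant d
  have h := (integrable_gauss (d := d) (a := 2 / σ ^ 2) (by positivity)).comp_sub_right p
  refine h.congr (Filter.Eventually.of_forall fun u => ?_)
  simp only [gaussFeat, pt_sub, norm_sub_rev (pt u)]
  ring_nf

/-- Against a skew-symmetric function, the Gaussian convolution is a pairing with `pairFeat`. -/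
theorem gaussConv_eq_integral_pairFeat {d : ℕ} {σ : ℝ} (hσ : 0 < σ) {F : Feat d × Feat d → ℝ}
    (hF : Measurable F) (hF1 : ∀ w, |F w| ≤ 1) (hskew : ∀ w, F w.swap = -F w)
    (p : Feat d × Feat d) :
    gaussConv σ F p = (2 / (Real.pi * σ ^ 2)) ^ d * ∫ u, pairFeat σ p u * F u := by
  have hi : ∀ p, Integrable fun u => gaussFeat σ p u * F u := fun p =>
    (integrable_gaussFeat hσ p).mul_bdd (c := 1) hF.aestronglyMeasurable
      (Filter.Eventually.of_forall fun w => by simpa using hF1 w)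
  -- The swap preserves Lebesgue measure and changes the sign of `F`, so the two halves of
  -- `pairFeat` contribute equally.
  have hswap : ∫ u, gaussFeat σ p.swap u * F u = -∫ u, gaussFeat σ p u * F u := by
    have hmp : MeasurePreserving (Prod.swap : Feat d × Feat d → Feat d × Feat d) :=
      Measure.measurePreserving_swap
    rw [← hmp.integral_comp MeasurableEquiv.prodComm.measurableEmbedding, ← integral_neg]
    refine integral_congr_ae (Filter.Eventually.of_forall fun u => ?_)
    have : gaussFeat σ p.swap u.swap = gaussFeat σ p u := by
      simp only [gaussFeat, norm_pt_sub_sq, Prod.fst_swap, Prod.snd_swap]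
      rw [add_comm]
    simp only [this, hskew]
    ring
  have : ∫ u, pairFeat σ p u * F u = ∫ u, gaussFeat σ p u * F u := by
    calc _ = ∫ u, 1 / 2 * (gaussFeat σ p u * F u - gaussFeat σ p.swap u * F u) := by
          refine integral_congr_ae (Filter.Eventually.of_forall fun u => ?_)
          simp only [pairFeat]; ring
      _ = _ := by
          rw [integral_const_mul, integral_sub (hi _) (hi _), hswap]; ring
  rw [this]; rfl

/-- By the reproducing property, the Gram matrix of the kernel functions is the kernel matrix. -/
theorem norm_sq_sum_kerFun {d : ℕ} (X : Set (Feat d)) {σ : ℝ} (c : X × X →₀ ℝ) :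
    ‖c.sum fun z t => t • RKHS.kerFun (GaussRKHS X σ) z (1 : ℝ)‖ ^ 2
      = ∑ p ∈ c.support, ∑ q ∈ c.support, c p * c q * pairKer σ (val₂ p) (val₂ q) := by
  rw [← real_inner_self_eq_norm_sq, Finsupp.sum, sum_inner]
  refine Finset.sum_congr rfl fun p _ => ?_
  rw [inner_sum]
  refine Finset.sum_congr rfl fun q _ => ?_
  rw [real_inner_smul_left, real_inner_smul_right, ← RKHS.kernel_inner, RKHS.OfKernel.kernel_ofKernel]
  simp [kerMat, pairKer_comm σ (val₂ q) (val₂ p)]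
  ring

/-- Gaussian convolutions of bounded skew-symmetric functions of bounded support belong to the
reproducing kernel Hilbert space of the pairwise Gaussian kernel. -/
theorem exists_gaussRKHS_eq_gaussConv {d : ℕ} (hd : 0 < d) (X : Set (Feat d)) {σ R : ℝ}
    (hσ : 0 < σ) (hR : 0 ≤ R) {F : Feat d × Feat d → ℝ}
    (hF : Measurable F) (hF1 : ∀ w, |F w| ≤ 1) (hskew : ∀ w, F w.swap = -F w)
    (hsupp : ∀ w, R < ‖pt w‖ → F w = 0) :
    ∃ g : GaussRKHS X σ, (∀ p, g p = gaussConv σ F (val₂ p)) ∧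
      ‖g‖ ^ 2 ≤ R ^ (2 * d) / (Real.Gamma (d + 1) * σ ^ (2 * d)) := by
  have hpi := Real.pi_pos
  set c₀ : ℝ := (2 / (Real.pi * σ ^ 2)) ^ d with hc₀
  set A : ℝ := (Real.pi / (4 / σ ^ 2)) ^ d with hA
  set V : ℝ := volume.real {u : Feat d × Feat d | ‖pt u‖ ≤ R} with hV
  have hV0 : 0 ≤ V := measureReal_nonneg
  have hA0 : 0 < A := by positivity
  have hS : MeasurableSet {u : Feat d × Feat d | ‖pt u‖ ≤ R} :=
    measurableSet_le continuous_pt.norm.measurable measurable_const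
  have hfin : volume {u : Feat d × Feat d | ‖pt u‖ ≤ R} < ∞ := by
    have : {u : Feat d × Feat d | ‖pt u‖ ≤ R} = pt ⁻¹' Metric.closedBall 0 R := by ext u; simp
    rw [this, (measurePreserving_pt d).measure_preimage
      Metric.isClosed_closedBall.nullMeasurableSet]
    exact measure_closedBall_lt_top
  have hFi : Integrable F := by
    refine Integrable.mono' (g := Set.indicator {u : Feat d × Feat d | ‖pt u‖ ≤ R} 1)
      ((integrable_indicator_iff hS).2 (integrableOn_const hfin.ne)) hF.aestronglyMeasurable
      (Filter.Eventually.of_forall fun u => ?_)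
    by_cases hu : ‖pt u‖ ≤ R
    · rw [Set.indicator_of_mem (by exact hu)]; exact hF1 u
    · rw [hsupp u (not_le.1 hu), norm_zero]
      exact Set.indicator_nonneg (fun _ _ => zero_le_one) _
  have hFsq : Integrable (fun u => F u ^ 2) := by
    simp only [sq]
    exact hFi.mul_bdd (c := 1) hF.aestronglyMeasurable (Filter.Eventually.of_forall hF1)
  have hFV : ∫ u, F u ^ 2 ≤ V := by
    rw [hV, ← integral_indicator_one hS]
    refine integral_mono hFsq ((integrable_indicator_iff hS).2 (integrableOn_const hfin.ne))
      fun u => ?_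
    by_cases hu : ‖pt u‖ ≤ R
    · rw [Set.indicator_of_mem (by exact hu)]
      exact (sq_le_one_iff_abs_le_one _).2 (hF1 u)
    · simp only [hsupp u (not_le.1 hu)]
      rw [Set.indicator_of_notMem (by exact hu)]
      norm_num
  -- A finite combination of values of `f₀` is `c₀ ∫ G F`, where `∫ G²` is `A` times the squared
  -- RKHS norm of the same combination of kernel functions and `∫ F² ≤ V`. Cauchy–Schwarz then gives
  -- the factor `√(c₀² A V)`.
  have hbound : ∀ c : X × X →₀ ℝ, |c.sum fun z t => t * gaussConv σ F (val₂ z)| ≤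
      √(c₀ ^ 2 * A * V) * ‖c.sum fun z t => t • RKHS.kerFun (GaussRKHS X σ) z (1 : ℝ)‖ := by
    intro c
    set k := c.sum fun z t => t • RKHS.kerFun (GaussRKHS X σ) z (1 : ℝ)
    set G : Feat d × Feat d → ℝ := fun u => ∑ z ∈ c.support, c z * pairFeat σ (val₂ z) u with hG
    have hpF : ∀ z, Integrable fun u => c z * (pairFeat σ (val₂ z) u * F u) := fun z =>
      ((((integrable_gaussFeat hσ _).sub (integrable_gaussFeat hσ _)).const_mul _).mul_bdd (c := 1)
        hF.aestronglyMeasurable (Filter.Eventually.of_forall hF1)).const_mul _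
    have hGFe : (fun u => G u * F u)
        = fun u => ∑ z ∈ c.support, c z * (pairFeat σ (val₂ z) u * F u) := by
      ext u; simp only [hG, Finset.sum_mul, mul_assoc]
    have hGF : c.sum (fun z t => t * gaussConv σ F (val₂ z)) = c₀ * ∫ u, G u * F u := by
      rw [hGFe, integral_finsetSum _ fun z _ => hpF z, Finset.mul_sum, Finsupp.sum]
      refine Finset.sum_congr rfl fun z _ => ?_
      rw [gaussConv_eq_integral_pairFeat hσ hF hF1 hskew, integral_const_mul]
      ring
    have hGFi : Integrable fun u => G u * F u := by
      rw [hGFe]; exact integrable_finsetSum _ fun z _ => hpF z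
    have hGe : (fun u => G u ^ 2) = fun u => ∑ p ∈ c.support, ∑ q ∈ c.support,
        c p * c q * (pairFeat σ (val₂ p) u * pairFeat σ (val₂ q) u) := by
      ext u
      simp only [hG, sq, Finset.sum_mul_sum]
      exact Finset.sum_congr rfl fun p _ => Finset.sum_congr rfl fun q _ => by ring
    have hpp := fun p q : X × X =>
      (integrable_pairFeat_mul hσ (val₂ p) (val₂ q)).const_mul (c p * c q)
    have hGi : Integrable fun u => G u ^ 2 := by
      rw [hGe]; exact integrable_finsetSum _ fun p _ => integrable_finsetSum _ fun q _ => hpp p q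
    have hGG : ∫ u, G u ^ 2 = A * ‖k‖ ^ 2 := by
      rw [hGe, norm_sq_sum_kerFun, integral_finsetSum _ fun p _ =>
        integrable_finsetSum _ fun q _ => hpp p q, Finset.mul_sum]
      refine Finset.sum_congr rfl fun p _ => ?_
      rw [integral_finsetSum _ fun q _ => hpp p q, Finset.mul_sum]
      refine Finset.sum_congr rfl fun q _ => ?_
      rw [integral_const_mul, integral_pairFeat_mul hσ]
      ring
    rw [hGF]
    refine abs_le_of_sq_le_sq ?_ (by positivity)
    have hcs := sq_integral_mul_le hGi hFsq hGFi
    rw [hGG] at hcs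
    rw [mul_pow, mul_pow, Real.sq_sqrt (by positivity)]
    calc c₀ ^ 2 * (∫ u, G u * F u) ^ 2 ≤ c₀ ^ 2 * (A * ‖k‖ ^ 2 * V) := by
          gcongr
          exact hcs.trans (by gcongr)
      _ = c₀ ^ 2 * A * V * ‖k‖ ^ 2 := by ring
  obtain ⟨g, hg, hgn⟩ := RKHS.exists_of_forall_finsupp_bound (H := GaussRKHS X σ)
    (fun p => gaussConv σ F (val₂ p)) (Real.sqrt_nonneg _) hbound
  refine ⟨g, hg, ?_⟩
  calc ‖g‖ ^ 2 ≤ √(c₀ ^ 2 * A * V) ^ 2 := by gcongr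
    _ = c₀ ^ 2 * A * V := Real.sq_sqrt (by positivity)
    _ = _ := by
      rw [hV, volumeReal_norm_pt_le hd hR, hc₀, hA, ← pow_mul, mul_comm d 2, pow_mul, ← mul_pow,
        pow_mul R, pow_mul σ]
      have e : (2 / (Real.pi * σ ^ 2)) ^ 2 * (Real.pi / (4 / σ ^ 2))
          = 1 / (Real.pi * σ ^ 2) := by field_simp; norm_num
      rw [e, div_pow, mul_pow, one_pow]
      field_simp

/-! ### Symmetry of the posterior classes and the margin-preserving extension. -/

section Extension

variable {d : ℕ} {X : Set (Feat d)} {Y : Set ℝ}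

theorem etaPos_swap (κ : Kernel X Y) [IsMarkovKernel κ] (p : X × X) :
    etaPos κ p.swap = etaNeg κ p := by
  unfold etaPos etaNeg
  rw [Prod.fst_swap, Prod.snd_swap, ← Measure.prod_swap, measureReal_def, measureReal_def,
    Measure.map_apply measurable_swap]
  · rfl
  · exact measurableSet_lt (by fun_prop) (by fun_prop)

theorem etaNeg_swap (κ : Kernel X Y) [IsMarkovKernel κ] (p : X × X) :
    etaNeg κ p.swap = etaPos κ p := by
  rw [← etaPos_swap, Prod.swap_swap]

theorem measurable_etaPos (κ : Kernel X Y) [IsMarkovKernel κ] : Measurable (etaPos κ) := by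
  have hs : MeasurableSet {q : Y × Y | (q.2 : ℝ) < (q.1 : ℝ)} :=
    measurableSet_lt (by fun_prop) (by fun_prop)
  have h := ((κ.comap (Prod.fst : X × X → X) measurable_fst) ×ₖ
    (κ.comap (Prod.snd : X × X → X) measurable_snd)).measurable_coe hs
  convert! h.ennreal_toReal using 2 with p
  simp [etaPos, measureReal_def, Kernel.prod_apply]

theorem measurable_etaNeg (κ : Kernel X Y) [IsMarkovKernel κ] : Measurable (etaNeg κ) := by
  have : etaNeg κ = etaPos κ ∘ Prod.swap := by ext p; simp [etaPos_swap]
  rw [this]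
  exact (measurable_etaPos κ).comp measurable_swap

theorem measurableSet_posSet (κ : Kernel X Y) [IsMarkovKernel κ] : MeasurableSet (posSet κ) :=
  measurableSet_lt (measurable_etaNeg κ) (measurable_etaPos κ)

theorem measurableSet_negSet (κ : Kernel X Y) [IsMarkovKernel κ] : MeasurableSet (negSet κ) :=
  measurableSet_lt (measurable_etaPos κ) (measurable_etaNeg κ)

theorem swap_mem_posSet (κ : Kernel X Y) [IsMarkovKernel κ] (p : X × X) :
    p.swap ∈ posSet κ ↔ p ∈ negSet κ := by
  simp [posSet, negSet, etaPos_swap, etaNeg_swap]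

theorem swap_mem_negSet (κ : Kernel X Y) [IsMarkovKernel κ] (p : X × X) :
    p.swap ∈ negSet κ ↔ p ∈ posSet κ := by
  simp [posSet, negSet, etaPos_swap, etaNeg_swap]

theorem swap_mem_eqSet (κ : Kernel X Y) [IsMarkovKernel κ] (p : X × X) :
    p.swap ∈ eqSet κ ↔ p ∈ eqSet κ := by
  simp [eqSet, etaPos_swap, etaNeg_swap, eq_comm]

theorem diag_mem_eqSet (κ : Kernel X Y) [IsMarkovKernel κ] (x : X) : (x, x) ∈ eqSet κ :=
  etaPos_swap κ (x, x)

theorem disjoint_posSet_negSet (κ : Kernel X Y) : Disjoint (posSet κ) (negSet κ) :=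
  Set.disjoint_left.2 fun _ h h' => lt_asymm (Set.mem_ofPred.1 h) (Set.mem_ofPred.1 h')

theorem bayesRule_of_mem_posSet {κ : Kernel X Y} {p : X × X} (h : p ∈ posSet κ) :
    bayesRule κ p = 1 :=
  Real.sign_of_pos (sub_pos.2 h)

theorem bayesRule_of_mem_negSet {κ : Kernel X Y} {p : X × X} (h : p ∈ negSet κ) :
    bayesRule κ p = -1 :=
  Real.sign_of_neg (sub_neg.2 h)

theorem bayesRule_of_notMem {κ : Kernel X Y} {p : X × X} (h : p ∉ posSet κ)
    (h' : p ∉ negSet κ) : bayesRule κ p = 0 := by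
  have : etaPos κ p = etaNeg κ p := le_antisymm (not_lt.1 h) (not_lt.1 h')
  simp [bayesRule, this]

theorem boundaryDist_of_mem_posSet {κ : Kernel X Y} {p : X × X} (h : p ∈ posSet κ) :
    boundaryDist κ p = distTo p (negSet κ ∪ eqSet κ) := by
  simp [boundaryDist, h]

theorem boundaryDist_of_mem_negSet {κ : Kernel X Y} {p : X × X} (h : p ∈ negSet κ) :
    boundaryDist κ p = distTo p (posSet κ ∪ eqSet κ) := by
  simp [boundaryDist, h, (disjoint_posSet_negSet κ).notMem_of_mem_right h]

theorem boundaryDist_of_notMem {κ : Kernel X Y} {p : X × X} (h : p ∉ posSet κ)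
    (h' : p ∉ negSet κ) : boundaryDist κ p = 0 := by
  simp [boundaryDist, h, h']

theorem boundaryDist_nonneg (κ : Kernel X Y) (p : X × X) : 0 ≤ boundaryDist κ p := by
  unfold boundaryDist distTo
  split_ifs
  · exact Metric.infDist_nonneg
  · exact Metric.infDist_nonneg
  · exact le_rfl

theorem continuous_pt_val₂ : Continuous fun p : X × X => pt (val₂ p) :=
  continuous_pt.comp (by unfold val₂; fun_prop)

theorem measurable_boundaryDist (κ : Kernel X Y) [IsMarkovKernel κ] :
    Measurable (boundaryDist κ) := by
  unfold boundaryDist distTo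
  refine Measurable.ite (measurableSet_posSet κ) ?_
    (Measurable.ite (measurableSet_negSet κ) ?_ measurable_const)
  · exact ((Metric.continuous_infDist_pt _).comp continuous_pt_val₂).measurable
  · exact ((Metric.continuous_infDist_pt _).comp continuous_pt_val₂).measurable

theorem dist_pt_swap (p q : Feat d × Feat d) : dist (pt p.swap) (pt q.swap) = dist (pt p) (pt q) := by
  rw [dist_eq_norm, dist_eq_norm, ← sq_eq_sq₀ (norm_nonneg _) (norm_nonneg _), norm_pt_sub_sq,
    norm_pt_sub_sq]
  exact add_comm _ _

theorem distTo_swap (p : X × X) (A : Set (X × X)) :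
    distTo p.swap A = distTo p (Prod.swap ⁻¹' A) := by
  -- Indexing the infimum by `X × X` rather than by the image set lets the swap act as a reindexing.
  have h : ∀ (p : X × X) (A : Set (X × X)), distTo p A
      = (⨅ q : X × X, ⨅ _ : q ∈ A, edist (pt (val₂ p)) (pt (val₂ q))).toReal := by
    intro p A
    rw [distTo, Metric.infDist, Metric.infEDist, iInf_image]
  rw [h, h]
  congr 1
  refine ((Equiv.prodComm X X).iInf_congr fun q => ?_).symm
  have e : edist (pt (val₂ p.swap)) (pt (val₂ q.swap)) = edist (pt (val₂ p)) (pt (val₂ q)) := by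
    rw [edist_dist, edist_dist, ← dist_pt_swap (val₂ p)]
    rfl
  simp only [Equiv.prodComm_apply, Set.mem_preimage, e]

theorem boundaryDist_swap (κ : Kernel X Y) [IsMarkovKernel κ] (p : X × X) :
    boundaryDist κ p.swap = boundaryDist κ p := by
  by_cases h : p ∈ posSet κ
  · rw [boundaryDist_of_mem_posSet h, boundaryDist_of_mem_negSet ((swap_mem_negSet κ p).2 h),
      distTo_swap]
    congr 1
    ext q
    simp [swap_mem_posSet, swap_mem_eqSet]
  by_cases h' : p ∈ negSet κ
  · rw [boundaryDist_of_mem_negSet h', boundaryDist_of_mem_posSet ((swap_mem_posSet κ p).2 h'),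
      distTo_swap]
    congr 1
    ext q
    simp [swap_mem_negSet, swap_mem_eqSet]
  rw [boundaryDist_of_notMem h h', boundaryDist_of_notMem]
  · rwa [swap_mem_posSet]
  · rwa [swap_mem_negSet]

theorem distTo_le_dist {p q : X × X} {A : Set (X × X)} (h : q ∈ A) :
    distTo p A ≤ dist (pt (val₂ p)) (pt (val₂ q)) :=
  Metric.infDist_le_dist_of_mem (Set.mem_image_of_mem _ h)

theorem boundaryDist_le_dist_of_mem_posSet {κ : Kernel X Y} {p q : X × X} (hp : p ∈ posSet κ)
    (hq : q ∉ posSet κ) : boundaryDist κ p ≤ dist (pt (val₂ p)) (pt (val₂ q)) := by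
  rw [boundaryDist_of_mem_posSet hp]
  refine distTo_le_dist ?_
  rcases (not_lt.1 hq : etaPos κ q ≤ etaNeg κ q).lt_or_eq with h | h
  exacts [Or.inl h, Or.inr h]

theorem boundaryDist_le_dist_of_mem_negSet {κ : Kernel X Y} {p q : X × X} (hp : p ∈ negSet κ)
    (hq : q ∉ negSet κ) : boundaryDist κ p ≤ dist (pt (val₂ p)) (pt (val₂ q)) := by
  rw [boundaryDist_of_mem_negSet hp]
  refine distTo_le_dist ?_
  rcases (not_lt.1 hq : etaNeg κ q ≤ etaPos κ q).lt_or_eq with h | h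
  exacts [Or.inl h, Or.inr h.symm]

/-- The diagonal point `(p.1, p.1)` is a tie, so it belongs to the set from which the margin of `p`
is measured. -/
theorem boundaryDist_le_two_mul {r : ℝ} (hr : 0 < r) (hXr : ∀ p : X × X, ‖pt (val₂ p)‖ ≤ r)
    (κ : Kernel X Y) [IsMarkovKernel κ] (p : X × X) : boundaryDist κ p ≤ 2 * r := by
  have hd : dist (pt (val₂ p)) (pt (val₂ (p.1, p.1))) ≤ 2 * r :=
    (dist_le_norm_add_norm _ _).trans (by linarith [hXr p, hXr (p.1, p.1)])
  have he : etaPos κ (p.1, p.1) = etaNeg κ (p.1, p.1) := diag_mem_eqSet κ p.1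
  by_cases h : p ∈ posSet κ
  · exact (boundaryDist_le_dist_of_mem_posSet h (not_lt.2 he.le)).trans hd
  by_cases h' : p ∈ negSet κ
  · exact (boundaryDist_le_dist_of_mem_negSet h' (not_lt.2 he.ge)).trans hd
  rw [boundaryDist_of_notMem h h']
  positivity

/-- The points of a set of pairs together with the open balls around them of radius half the
distance to the decision boundary. -/
def marginHull (κ : Kernel X Y) (A : Set (X × X)) : Set (Feat d × Feat d) :=
  val₂ '' A ∪ ⋃ p ∈ A, {w | dist (pt w) (pt (val₂ p)) < boundaryDist κ p / 2}

theorem mem_marginHull {κ : Kernel X Y} {A : Set (X × X)} {w : Feat d × Feat d} :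
    w ∈ marginHull κ A ↔ ∃ p ∈ A, w = val₂ p ∨
      dist (pt w) (pt (val₂ p)) < boundaryDist κ p / 2 := by
  simp only [marginHull, Set.mem_union, Set.mem_image, Set.mem_iUnion, Set.mem_ofPred_eq,
    exists_prop, ← exists_or, ← and_or_left, eq_comm]

/-- The union of balls is open even over an uncountable index set. The centres need separate
treatment, because a ball is empty where the margin vanishes; their image is Borel since the compact
`X` is. -/
theorem measurableSet_marginHull (hX : IsCompact X) (κ : Kernel X Y) {A : Set (X × X)}
    (hA : MeasurableSet A) : MeasurableSet (marginHull κ A) := by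
  refine MeasurableSet.union ?_ (IsOpen.measurableSet ?_)
  · have : MeasurableEmbedding (val₂ (X := X)) :=
      (MeasurableEmbedding.subtype_coe hX.measurableSet).prodMap
        (MeasurableEmbedding.subtype_coe hX.measurableSet)
    exact this.measurableSet_image.2 hA
  · refine isOpen_biUnion fun p _ => ?_
    have := continuous_pt (d := d)
    exact isOpen_lt (by fun_prop) continuous_const

theorem swap_mem_marginHull (κ : Kernel X Y) [IsMarkovKernel κ] (A : Set (X × X))
    (w : Feat d × Feat d) : w.swap ∈ marginHull κ A ↔ w ∈ marginHull κ (Prod.swap ⁻¹' A) := by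
  have key : ∀ (p : X × X) (w : Feat d × Feat d), (w.swap = val₂ p.swap ∨
      dist (pt w.swap) (pt (val₂ p.swap)) < boundaryDist κ p.swap / 2) ↔
      (w = val₂ p ∨ dist (pt w) (pt (val₂ p)) < boundaryDist κ p / 2) := by
    intro p w
    have : val₂ p.swap = (val₂ p).swap := rfl
    rw [this, dist_pt_swap, boundaryDist_swap, Prod.swap_injective.eq_iff]
  simp only [mem_marginHull]
  constructor
  · rintro ⟨p, hp, h⟩
    exact ⟨p.swap, by simpa using hp, by rwa [← key, Prod.swap_swap]⟩
  · rintro ⟨p, hp, h⟩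
    exact ⟨p.swap, hp, by rwa [key]⟩

/-- Each of the margins of `p` and `q` is at most `dist p q`. A common point of the two half-margin
balls would make that distance smaller than the average of the margins. -/
theorem disjoint_marginHull (κ : Kernel X Y) :
    Disjoint (marginHull κ (posSet κ)) (marginHull κ (negSet κ)) := by
  refine Set.disjoint_left.2 fun w hw hw' => ?_
  obtain ⟨p, hp, h⟩ := mem_marginHull.1 hw
  obtain ⟨q, hq, h'⟩ := mem_marginHull.1 hw'
  have hqp := (disjoint_posSet_negSet κ).notMem_of_mem_right hq
  have hpq := (disjoint_posSet_negSet κ).notMem_of_mem_left hp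
  have h1 := boundaryDist_le_dist_of_mem_posSet hp hqp
  have h2 := boundaryDist_le_dist_of_mem_negSet hq hpq
  have h3 := boundaryDist_nonneg κ p
  have h4 := boundaryDist_nonneg κ q
  rw [dist_comm] at h2
  have tri := dist_triangle_left (pt (val₂ p)) (pt (val₂ q)) (pt w)
  rcases h with rfl | h
  · rcases h' with h' | h'
    · rw [val₂, val₂, Prod.mk.injEq, Subtype.coe_inj, Subtype.coe_inj] at h'
      exact hpq (by rwa [Prod.ext h'.1 h'.2])
    · rw [dist_self] at tri; linarith
  · rcases h' with rfl | h'
    · rw [dist_self] at tri; linarith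
    · linarith

theorem val₂_mem_marginHull (κ : Kernel X Y) {A : Set (X × X)} {p : X × X} (hp : p ∈ A) :
    val₂ p ∈ marginHull κ A := mem_marginHull.2 ⟨p, hp, Or.inl rfl⟩

theorem val₂_mem_marginHull_posSet (κ : Kernel X Y) (p : X × X) :
    val₂ p ∈ marginHull κ (posSet κ) ↔ p ∈ posSet κ := by
  refine ⟨fun h => ?_, val₂_mem_marginHull κ⟩
  obtain ⟨q, hq, h | h⟩ := mem_marginHull.1 h
  · rw [val₂, val₂, Prod.mk.injEq, Subtype.coe_inj, Subtype.coe_inj] at h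
    rwa [Prod.ext h.1 h.2]
  · by_contra hp
    have := boundaryDist_le_dist_of_mem_posSet hq hp
    rw [dist_comm] at this
    linarith [boundaryDist_nonneg κ q]

theorem val₂_mem_marginHull_negSet (κ : Kernel X Y) (p : X × X) :
    val₂ p ∈ marginHull κ (negSet κ) ↔ p ∈ negSet κ := by
  refine ⟨fun h => ?_, val₂_mem_marginHull κ⟩
  obtain ⟨q, hq, h | h⟩ := mem_marginHull.1 h
  · rw [val₂, val₂, Prod.mk.injEq, Subtype.coe_inj, Subtype.coe_inj] at h
    rwa [Prod.ext h.1 h.2]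
  · by_contra hp
    have := boundaryDist_le_dist_of_mem_negSet hq hp
    rw [dist_comm] at this
    linarith [boundaryDist_nonneg κ q]

open Classical in
/-- The margin-preserving extension of the Bayes rule to `ℝ^{2d}`. -/
noncomputable def marginExt (κ : Kernel X Y) (w : Feat d × Feat d) : ℝ :=
  if w ∈ marginHull κ (posSet κ) then 1 else if w ∈ marginHull κ (negSet κ) then -1 else 0

theorem isMarginExtension_marginExt (hX : IsCompact X) {r : ℝ} (hr : 0 < r)
    (hXr : ∀ p : X × X, ‖pt (val₂ p)‖ ≤ r) (κ : Kernel X Y) [IsMarkovKernel κ] :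
    IsMarginExtension κ r (marginExt κ) where
  measurable := by
    unfold marginExt
    exact Measurable.ite (measurableSet_marginHull hX κ (measurableSet_posSet κ)) measurable_const
      (Measurable.ite (measurableSet_marginHull hX κ (measurableSet_negSet κ)) measurable_const
        measurable_const)
  values w := by
    unfold marginExt; split_ifs <;> simp
  skew w := by
    have h1 : w.swap ∈ marginHull κ (posSet κ) ↔ w ∈ marginHull κ (negSet κ) := by
      rw [swap_mem_marginHull]
      congr! 2
      ext p; exact swap_mem_posSet κ p
    have h2 : w.swap ∈ marginHull κ (negSet κ) ↔ w ∈ marginHull κ (posSet κ) := by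
      rw [swap_mem_marginHull]
      congr! 2
      ext p; exact swap_mem_negSet κ p
    have hd := Set.disjoint_left.1 (disjoint_marginHull κ)
    have hd := @hd w
    unfold marginExt
    rw [h1, h2]
    split_ifs with a b <;> first | exact absurd b (by tauto) | simp
  support w hw := by
    have key : ∀ A, w ∉ marginHull κ A := by
      intro A hA
      obtain ⟨p, hp, rfl | h⟩ := mem_marginHull.1 hA
      · linarith [hXr p]
      · have := boundaryDist_le_two_mul hr hXr κ p
        -- The centre has norm at most `r` and the half margin is at most `r`.
        have h2 : ‖pt w‖ ≤ dist (pt w) (pt (val₂ p)) + ‖pt (val₂ p)‖ := by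
          rw [dist_eq_norm]; exact norm_le_norm_sub_add _ _
        linarith [hXr p]
    simp [marginExt, key]
  extends_bayes p := by
    unfold marginExt
    rw [val₂_mem_marginHull_posSet, val₂_mem_marginHull_negSet]
    split_ifs with h h'
    · exact (bayesRule_of_mem_posSet h).symm
    · exact (bayesRule_of_mem_negSet h').symm
    · exact (bayesRule_of_notMem h h').symm
  margin p w hw := by
    by_cases h : p ∈ posSet κ
    · have hm : w ∈ marginHull κ (posSet κ) := mem_marginHull.2 ⟨p, h, Or.inr hw⟩
      rw [bayesRule_of_mem_posSet h, marginExt, if_pos hm]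
    by_cases h' : p ∈ negSet κ
    · have hm : w ∈ marginHull κ (negSet κ) := mem_marginHull.2 ⟨p, h', Or.inr hw⟩
      rw [bayesRule_of_mem_negSet h', marginExt,
        if_neg ((disjoint_marginHull κ).notMem_of_mem_right hm), if_pos hm]
    · rw [boundaryDist_of_notMem h h', zero_div] at hw
      exact absurd hw (not_lt.2 dist_nonneg)

end Extension

/-! ### Disintegration of the hinge risk and optimality of the Bayes rule. -/

section Risk

variable {d : ℕ} {X : Set (Feat d)} {Y : Set ℝ}

/-- Two independent draws, disintegrated along the two features. -/
theorem lintegral_prod_self_of_isCondKernel (P : Measure (X × Y)) [IsProbabilityMeasure P]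
    (κ : Kernel X Y) [IsMarkovKernel κ] [P.IsCondKernel κ] {φ : (X × Y) × (X × Y) → ℝ≥0∞}
    (hφ : Measurable φ) :
    ∫⁻ z, φ z ∂(P.prod P) = ∫⁻ p : X × X, ∫⁻ q : Y × Y, φ ((p.1, q.1), (p.2, q.2))
      ∂((κ p.1).prod (κ p.2)) ∂(P.fst.prod P.fst) := by
  have hP : P.fst ⊗ₘ κ = P := P.disintegrate κ
  have h1 : ∀ g : X × Y → ℝ≥0∞, Measurable g →
      ∫⁻ a, g a ∂P = ∫⁻ x, ∫⁻ y, g (x, y) ∂(κ x) ∂P.fst := by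
    intro g hg
    conv_lhs => rw [← hP]
    exact Measure.lintegral_compProd hg
  have hin : Measurable fun p : X × X => ∫⁻ q : Y × Y, φ ((p.1, q.1), (p.2, q.2))
      ∂((κ p.1).prod (κ p.2)) := by
    have := Measurable.lintegral_kernel_prod_right'
      (κ := (κ.comap (Prod.fst : X × X → X) measurable_fst) ×ₖ
        (κ.comap (Prod.snd : X × X → X) measurable_snd))
      (f := fun w : (X × X) × (Y × Y) => φ ((w.1.1, w.2.1), (w.1.2, w.2.2)))
      (hφ.comp (by fun_prop))
    simpa [Kernel.prod_apply] using this
  rw [lintegral_prod _ hφ.aemeasurable, h1 _ hφ.lintegral_prod_right',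
    lintegral_prod _ hin.aemeasurable]
  refine lintegral_congr fun x => ?_
  have h2 : ∀ y, ∫⁻ b, φ ((x, y), b) ∂P = ∫⁻ x', ∫⁻ y', φ ((x, y), (x', y')) ∂(κ x') ∂P.fst :=
    fun y => h1 _ (hφ.comp (by fun_prop))
  simp only [h2]
  -- The first label and the second feature are exchanged, so that both features are integrated
  -- outside both labels.
  rw [lintegral_lintegral_swap]
  · refine lintegral_congr fun x' => ?_
    rw [lintegral_prod]
    exact (hφ.comp (by fun_prop)).aemeasurable
  · have := Measurable.lintegral_kernel_prod_right'
      (κ := κ.comap (Prod.snd : Y × X → X) measurable_snd)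
      (f := fun w : (Y × X) × Y => φ ((x, w.1.1), (w.1.2, w.2))) (hφ.comp (by fun_prop))
    simpa [Function.uncurry_def] using this.aemeasurable

theorem measurable_realSign : Measurable Real.sign := by
  unfold Real.sign
  exact Measurable.ite measurableSet_Iio measurable_const
    (Measurable.ite measurableSet_Ioi measurable_const measurable_const)

/-- The conditional hinge risk of a prediction `t` at a pair of points. -/
noncomputable def condRisk (κ : Kernel X Y) (p : X × X) (t : ℝ) : ℝ :=
  1 + (max (1 - t) 0 - 1) * etaPos κ p + (max (1 + t) 0 - 1) * etaNeg κ p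

theorem lintegral_hingeLoss (κ : Kernel X Y) [IsMarkovKernel κ] (p : X × X) (t : ℝ) :
    ∫⁻ q : Y × Y, ENNReal.ofReal (hingeLoss q.1 q.2 t) ∂((κ p.1).prod (κ p.2))
      = ENNReal.ofReal (condRisk κ p t) := by
  set S : Set (Y × Y) := {q | (q.2 : ℝ) < (q.1 : ℝ)} with hSdef
  set T : Set (Y × Y) := {q | (q.1 : ℝ) < (q.2 : ℝ)} with hTdef
  have hS : MeasurableSet S := measurableSet_lt (by fun_prop) (by fun_prop)
  have hT : MeasurableSet T := measurableSet_lt (by fun_prop) (by fun_prop)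
  -- Ties have loss `1`, the baseline; each indicator corrects it on one strict ordering of the
  -- labels.
  have hloss : ∀ q : Y × Y, hingeLoss q.1 q.2 t
      = 1 + (max (1 - t) 0 - 1) * S.indicator 1 q + (max (1 + t) 0 - 1) * T.indicator 1 q := by
    intro q
    rcases lt_trichotomy (q.1 : ℝ) (q.2 : ℝ) with h | h | h
    · have h1 : q ∉ S := not_lt.2 h.le
      have h2 : q ∈ T := h
      simp [hingeLoss, h1, h2, Real.sign_of_neg (sub_neg.2 h)]
    · have h1 : q ∉ S := not_lt.2 h.le
      have h2 : q ∉ T := not_lt.2 h.ge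
      simp [hingeLoss, h1, h2, h]
    · have h1 : q ∈ S := h
      have h2 : q ∉ T := not_lt.2 h.le
      simp [hingeLoss, h1, h2, Real.sign_of_pos (sub_pos.2 h)]
  have hi : ∀ {U : Set (Y × Y)} (c : ℝ), MeasurableSet U →
      Integrable (fun q => c * U.indicator 1 q) ((κ p.1).prod (κ p.2)) := fun c hU =>
    ((integrable_const (1 : ℝ)).indicator hU).const_mul c
  have hInt : Integrable (fun q : Y × Y => hingeLoss q.1 q.2 t) ((κ p.1).prod (κ p.2)) := by
    simp only [hloss]
    exact ((integrable_const _).add (hi _ hS)).add (hi _ hT)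
  rw [← ofReal_integral_eq_lintegral_ofReal hInt
    (Filter.Eventually.of_forall fun q => le_max_right _ _)]
  congr 1
  simp only [hloss]
  rw [integral_add (f := fun q => 1 + (max (1 - t) 0 - 1) * S.indicator 1 q)
      ((integrable_const _).add (hi _ hS)) (hi _ hT),
    integral_add (integrable_const _) (hi _ hS), integral_const_mul, integral_const_mul,
    integral_indicator_one hS, integral_indicator_one hT]
  simp [condRisk, etaPos, etaNeg, hSdef, hTdef]

theorem hingeRisk_eq (P : Measure (X × Y)) [IsProbabilityMeasure P]
    (κ : Kernel X Y) [IsMarkovKernel κ] [P.IsCondKernel κ] {f : X × X → ℝ} (hf : Measurable f) :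
    hingeRisk P f = ∫⁻ p, ENNReal.ofReal (condRisk κ p (f p)) ∂(P.fst.prod P.fst) := by
  have hm : Measurable fun z : (X × Y) × (X × Y) =>
      ENNReal.ofReal (hingeLoss z.1.2 z.2.2 (f (z.1.1, z.2.1))) := by
    unfold hingeLoss
    refine (((measurable_const.sub ((measurable_realSign.comp ?_).mul (hf.comp ?_))).max
      measurable_const)).ennreal_ofReal
    · fun_prop
    · fun_prop
  rw [hingeRisk, lintegral_prod_self_of_isCondKernel P κ hm]
  exact lintegral_congr fun p => lintegral_hingeLoss κ p (f p)

theorem condRisk_of_abs_le_one (κ : Kernel X Y) (p : X × X) {t : ℝ} (ht : |t| ≤ 1) :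
    condRisk κ p t = 1 - (etaPos κ p - etaNeg κ p) * t := by
  obtain ⟨h1, h2⟩ := abs_le.1 ht
  rw [condRisk, max_eq_left (by linarith), max_eq_left (by linarith)]
  ring

theorem mul_realSign_self (x : ℝ) : x * Real.sign x = |x| := by
  rcases lt_trichotomy x 0 with h | rfl | h
  · rw [Real.sign_of_neg h, abs_of_neg h]; ring
  · simp
  · rw [Real.sign_of_pos h, abs_of_pos h]; ring

theorem abs_realSign_le_one (x : ℝ) : |Real.sign x| ≤ 1 := by
  rcases Real.sign_apply_eq x with h | h | h <;> simp [h]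

theorem etaPos_nonneg (κ : Kernel X Y) (p : X × X) : 0 ≤ etaPos κ p := measureReal_nonneg

theorem etaNeg_nonneg (κ : Kernel X Y) (p : X × X) : 0 ≤ etaNeg κ p := measureReal_nonneg

theorem etaPos_le_one (κ : Kernel X Y) [IsMarkovKernel κ] (p : X × X) : etaPos κ p ≤ 1 :=
  measureReal_le_one

theorem etaNeg_le_one (κ : Kernel X Y) [IsMarkovKernel κ] (p : X × X) : etaNeg κ p ≤ 1 :=
  measureReal_le_one

theorem abs_eta_sub_le_one (κ : Kernel X Y) [IsMarkovKernel κ] (p : X × X) :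
    |etaPos κ p - etaNeg κ p| ≤ 1 := by
  rw [abs_le]
  constructor <;>
    linarith [etaPos_nonneg κ p, etaNeg_nonneg κ p, etaPos_le_one κ p, etaNeg_le_one κ p]

theorem measurable_bayesRule (κ : Kernel X Y) [IsMarkovKernel κ] : Measurable (bayesRule κ) :=
  measurable_realSign.comp ((measurable_etaPos κ).sub (measurable_etaNeg κ))

/-- Write `A = (1-t)₊` and `B = (1+t)₊`, so that `A + B ≥ 2`. When `η₊ ≥ η₋` the difference of the
two sides is `A (η₊ - η₋) + η₋ (A + B - 2) ≥ 0`; the other case is symmetric. -/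
theorem condRisk_bayesRule_le (κ : Kernel X Y) (p : X × X) (t : ℝ) :
    condRisk κ p (bayesRule κ p) ≤ condRisk κ p t := by
  have ha := etaPos_nonneg κ p
  have hb := etaNeg_nonneg κ p
  rw [bayesRule, condRisk_of_abs_le_one κ p (abs_realSign_le_one _), mul_realSign_self, condRisk]
  have h1 := le_max_left (1 - t) 0
  have h2 := le_max_right (1 - t) 0
  have h3 := le_max_left (1 + t) 0
  have h4 := le_max_right (1 + t) 0
  rcases le_total (etaNeg κ p) (etaPos κ p) with h | h
  · rw [abs_of_nonneg (sub_nonneg.2 h)]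
    nlinarith [mul_nonneg (sub_nonneg.2 h) h2, mul_nonneg hb (sub_nonneg.2 h1),
      mul_nonneg hb (sub_nonneg.2 h3)]
  · rw [abs_of_nonpos (sub_nonpos.2 h)]
    nlinarith [mul_nonneg (sub_nonneg.2 h) h4, mul_nonneg ha (sub_nonneg.2 h1),
      mul_nonneg ha (sub_nonneg.2 h3)]

theorem isHingeBayes_bayesRule (P : Measure (X × Y)) [IsProbabilityMeasure P]
    (κ : Kernel X Y) [IsMarkovKernel κ] [P.IsCondKernel κ] : IsHingeBayes P (bayesRule κ) := by
  refine ⟨measurable_bayesRule κ, fun g hg => ?_⟩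
  rw [hingeRisk_eq P κ (measurable_bayesRule κ), hingeRisk_eq P κ hg]
  exact lintegral_mono fun p => ENNReal.ofReal_le_ofReal (condRisk_bayesRule_le κ p (g p))

theorem integrable_eta_mul (μ : Measure (X × X)) [IsFiniteMeasure μ] (κ : Kernel X Y)
    [IsMarkovKernel κ] {f : X × X → ℝ} (hf : Measurable f) (hf1 : ∀ p, |f p| ≤ 1) :
    Integrable (fun p => (etaPos κ p - etaNeg κ p) * f p) μ := by
  refine Integrable.of_bound (C := 1)
    (((measurable_etaPos κ).sub (measurable_etaNeg κ)).mul hf).aestronglyMeasurable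
    (Filter.Eventually.of_forall fun p => ?_)
  rw [Real.norm_eq_abs, abs_mul]
  exact mul_le_one₀ (abs_eta_sub_le_one κ p) (abs_nonneg _) (hf1 p)

theorem toReal_hingeRisk (P : Measure (X × Y)) [IsProbabilityMeasure P]
    (κ : Kernel X Y) [IsMarkovKernel κ] [P.IsCondKernel κ] {f : X × X → ℝ} (hf : Measurable f)
    (hf1 : ∀ p, |f p| ≤ 1) :
    (hingeRisk P f).toReal
      = 1 - ∫ p, (etaPos κ p - etaNeg κ p) * f p ∂(P.fst.prod P.fst) := by
  have hi := integrable_eta_mul (P.fst.prod P.fst) κ hf hf1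
  have h0 : ∀ p, 0 ≤ 1 - (etaPos κ p - etaNeg κ p) * f p := fun p => by
    have : |(etaPos κ p - etaNeg κ p) * f p| ≤ 1 := by
      rw [abs_mul]; exact mul_le_one₀ (abs_eta_sub_le_one κ p) (abs_nonneg _) (hf1 p)
    linarith [le_abs_self ((etaPos κ p - etaNeg κ p) * f p)]
  rw [hingeRisk_eq P κ hf]
  simp only [condRisk_of_abs_le_one κ _ (hf1 _)]
  rw [← ofReal_integral_eq_lintegral_ofReal
    (f := fun p => 1 - (etaPos κ p - etaNeg κ p) * f p) ((integrable_const _).sub hi)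
    (Filter.Eventually.of_forall h0), ENNReal.toReal_ofReal (integral_nonneg h0),
    integral_sub (integrable_const _) hi]
  simp

theorem toReal_hingeRisk_sub_bayesRule (P : Measure (X × Y)) [IsProbabilityMeasure P]
    (κ : Kernel X Y) [IsMarkovKernel κ] [P.IsCondKernel κ] {f : X × X → ℝ} (hf : Measurable f)
    (hf1 : ∀ p, |f p| ≤ 1) :
    (hingeRisk P f).toReal - (hingeRisk P (bayesRule κ)).toReal
      = ∫ p, (etaPos κ p - etaNeg κ p) * (bayesRule κ p - f p) ∂(P.fst.prod P.fst) := by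
  have hb := measurable_bayesRule κ
  have hb1 : ∀ p, |bayesRule κ p| ≤ 1 := fun p => abs_realSign_le_one _
  rw [toReal_hingeRisk P κ hf hf1, toReal_hingeRisk P κ hb hb1]
  simp only [mul_sub]
  rw [integral_sub (integrable_eta_mul _ κ hb hb1) (integrable_eta_mul _ κ hf hf1)]
  ring

end Risk

/-! ### Excess risk of the Gaussian convolution under the margin-noise condition. -/

section Approximation

variable {d : ℕ} {X : Set (Feat d)} {Y : Set ℝ}

theorem integrable_abs_eta (μ : Measure (X × X)) [IsFiniteMeasure μ] (κ : Kernel X Y)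
    [IsMarkovKernel κ] : Integrable (fun p => |etaPos κ p - etaNeg κ p|) μ := by
  simpa using (integrable_eta_mul μ κ (f := fun _ => 1) measurable_const (by simp)).abs

/-- The event on which a shift may leave the open margin ball is a non-strict inequality. The
condition at levels `s > t` and continuity of the power as `s` decreases to `t` cover it. -/
theorem MarginNoise.setIntegral_le {P : Measure (X × Y)} [IsProbabilityMeasure P]
    {κ : Kernel X Y} [IsMarkovKernel κ] {C β : ℝ} (hβ : 0 < β) (h : MarginNoise P κ C β)
    {t : ℝ} (ht : 0 ≤ t) :
    ∫ p in {p | boundaryDist κ p ≤ t}, |etaPos κ p - etaNeg κ p| ∂(P.fst.prod P.fst)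
      ≤ C * t ^ β := by
  have hlim : Filter.Tendsto (fun s : ℝ => C * s ^ β) (nhdsWithin t (Set.Ioi t))
      (nhds (C * t ^ β)) :=
    (((Real.continuous_rpow_const hβ.le).tendsto t).const_mul C).mono_left nhdsWithin_le_nhds
  refine ge_of_tendsto hlim ?_
  filter_upwards [self_mem_nhdsWithin] with s hs
  have hs : t < s := hs
  refine le_trans ?_ (h s (ht.trans hs.le))
  refine setIntegral_mono_set (integrable_abs_eta _ κ).integrableOn
    (Filter.Eventually.of_forall fun p => abs_nonneg _) ?_
  exact (show {p | boundaryDist κ p ≤ t} ⊆ {p | boundaryDist κ p < s} from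
    fun p hp => lt_of_le_of_lt hp hs).eventuallyLE

theorem IsMarginExtension.abs_le_one {κ : Kernel X Y} {r : ℝ} {F : Feat d × Feat d → ℝ}
    (hF : IsMarginExtension κ r F) (w : Feat d × Feat d) : |F w| ≤ 1 := by
  rcases hF.values w with h | h | h <;> simp [h]

theorem abs_gaussConv_le_one {σ : ℝ} (hσ : 0 < σ) {F : Feat d × Feat d → ℝ}
    (hF1 : ∀ w, |F w| ≤ 1) (p : Feat d × Feat d) : |gaussConv σ F p| ≤ 1 := by
  have := isProbabilityMeasure_gaussLaw (d := d) hσ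
  rw [gaussConv_eq_integral_gaussLaw]
  simpa using norm_integral_le_of_norm_le_const (μ := gaussLaw d σ)
    (f := fun v => F (p + v)) (C := 1)
    (Filter.Eventually.of_forall fun v => hF1 (p + v))

theorem measurable_gaussConv {σ : ℝ} (hσ : 0 < σ) {F : Feat d × Feat d → ℝ} (hF : Measurable F) :
    Measurable (gaussConv σ F) := by
  have := isProbabilityMeasure_gaussLaw (d := d) hσ
  have e : gaussConv σ F = fun p => ∫ v, F (p + v) ∂(gaussLaw d σ) :=
    funext (gaussConv_eq_integral_gaussLaw σ F)
  rw [e]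
  exact ((hF.comp measurable_add).stronglyMeasurable.integral_prod_right
    (f := fun p v => F (p + v))).measurable

/-- Off the event a shift by `v` stays in the half-margin ball, where `F` equals the Bayes value; on
it the two values differ by at most `2`. -/
theorem IsMarginExtension.abs_bayesRule_sub_gaussConv_le {κ : Kernel X Y} {r σ : ℝ} (hσ : 0 < σ)
    {F : Feat d × Feat d → ℝ} (hF : IsMarginExtension κ r F) (p : X × X) :
    |bayesRule κ p - gaussConv σ F (val₂ p)|
      ≤ 2 * (gaussLaw d σ).real {v | boundaryDist κ p ≤ 2 * ‖pt v‖} := by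
  have := isProbabilityMeasure_gaussLaw (d := d) hσ
  have hS : MeasurableSet {v : Feat d × Feat d | boundaryDist κ p ≤ 2 * ‖pt v‖} :=
    measurableSet_le measurable_const (continuous_pt.norm.measurable.const_mul 2)
  have hi : Integrable (fun v => F (val₂ p + v)) (gaussLaw d σ) :=
    Integrable.of_bound (C := 1)
      (hF.measurable.comp (measurable_const_add _)).aestronglyMeasurable
      (Filter.Eventually.of_forall fun v => hF.abs_le_one _)
  have e : bayesRule κ p - gaussConv σ F (val₂ p)
      = ∫ v, (bayesRule κ p - F (val₂ p + v)) ∂(gaussLaw d σ) := by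
    rw [integral_sub (integrable_const _) hi, gaussConv_eq_integral_gaussLaw]
    simp
  rw [e, ← Real.norm_eq_abs, ← integral_indicator_one hS, ← integral_const_mul]
  refine norm_integral_le_of_norm_le (((integrable_const _).indicator hS).const_mul _)
    (Filter.Eventually.of_forall fun v => ?_)
  by_cases hv : boundaryDist κ p ≤ 2 * ‖pt v‖
  · rw [Set.indicator_of_mem (by exact hv), Real.norm_eq_abs, Pi.one_apply, mul_one]
    have h1 := abs_sub (bayesRule κ p) (F (val₂ p + v))
    have h2 : |bayesRule κ p| ≤ 1 := abs_realSign_le_one _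
    linarith [hF.abs_le_one (val₂ p + v)]
  · have : F (val₂ p + v) = bayesRule κ p := by
      refine hF.margin p _ ?_
      rw [dist_eq_norm, ← pt_sub, add_sub_cancel_left]
      linarith [not_le.1 hv]
    rw [Set.indicator_of_notMem (by exact hv), this]
    simp

/-- Fubini: with `v` fixed, the inner integral is the margin-noise integral at level `2‖v‖`. -/
theorem integral_abs_eta_mul_gaussLaw_le (hd : 0 < d) {P : Measure (X × Y)}
    [IsProbabilityMeasure P] {κ : Kernel X Y} [IsMarkovKernel κ] {C β σ : ℝ} (hσ : 0 < σ)
    (hβ : 0 < β) (h : MarginNoise P κ C β) :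
    ∫ p, |etaPos κ p - etaNeg κ p| *
        (gaussLaw d σ).real {v | boundaryDist κ p ≤ 2 * ‖pt v‖} ∂(P.fst.prod P.fst)
      ≤ ∫ v, C * (2 * ‖pt v‖) ^ β ∂(gaussLaw d σ) := by
  have := isProbabilityMeasure_gaussLaw (d := d) hσ
  set E : Set ((X × X) × (Feat d × Feat d)) := {z | boundaryDist κ z.1 ≤ 2 * ‖pt z.2‖} with hEdef
  have hE : MeasurableSet E :=
    measurableSet_le ((measurable_boundaryDist κ).comp measurable_fst)
      ((continuous_pt.norm.measurable.comp measurable_snd).const_mul 2)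
  have hEv : ∀ p, MeasurableSet {v : Feat d × Feat d | boundaryDist κ p ≤ 2 * ‖pt v‖} := fun p =>
    measurableSet_le measurable_const (continuous_pt.norm.measurable.const_mul 2)
  have hEp : ∀ t, MeasurableSet {p | boundaryDist κ p ≤ t} := fun t =>
    measurableSet_le (measurable_boundaryDist κ) measurable_const
  have hint : Integrable (E.indicator fun z => |etaPos κ z.1 - etaNeg κ z.1|)
      ((P.fst.prod P.fst).prod (gaussLaw d σ)) :=
    ((integrable_abs_eta (P.fst.prod P.fst) κ).comp_fst (gaussLaw d σ)).indicator hE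
  have h1 : ∀ p, ∫ v, E.indicator (fun z => |etaPos κ z.1 - etaNeg κ z.1|) (p, v) ∂(gaussLaw d σ)
      = |etaPos κ p - etaNeg κ p| *
        (gaussLaw d σ).real {v | boundaryDist κ p ≤ 2 * ‖pt v‖} := by
    intro p
    rw [← integral_indicator_one (hEv p), ← integral_const_mul]
    refine integral_congr_ae (Filter.Eventually.of_forall fun v => ?_)
    by_cases hv : boundaryDist κ p ≤ 2 * ‖pt v‖ <;> simp [Set.indicator, hEdef, hv]
  have h2 : ∀ v, ∫ p, E.indicator (fun z => |etaPos κ z.1 - etaNeg κ z.1|) (p, v)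
        ∂(P.fst.prod P.fst)
      = ∫ p in {p | boundaryDist κ p ≤ 2 * ‖pt v‖}, |etaPos κ p - etaNeg κ p|
        ∂(P.fst.prod P.fst) := by
    intro v
    rw [← integral_indicator (hEp _)]
    refine integral_congr_ae (Filter.Eventually.of_forall fun p => ?_)
    by_cases hv : boundaryDist κ p ≤ 2 * ‖pt v‖ <;> simp [Set.indicator, hEdef, hv]
  have hsw := integral_integral_swap
    (f := fun p v => E.indicator (fun z => |etaPos κ z.1 - etaNeg κ z.1|) (p, v)) hint
  simp only [h1, h2] at hsw
  rw [hsw]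
  refine integral_mono ?_ ?_ fun v => h.setIntegral_le hβ (by positivity)
  · have := hint.integral_prod_right
    simpa only [h2] using this
  · refine (((integrable_norm_rpow_gaussLaw hd hσ hβ).const_mul (2 ^ β)).const_mul C).congr
      (Filter.Eventually.of_forall fun v => ?_)
    simp only [Real.mul_rpow zero_le_two (norm_nonneg _)]

theorem integral_const_mul_rpow_gaussLaw (hd : 0 < d) {C β σ : ℝ} (hσ : 0 < σ) (hβ : 0 < β) :
    2 * ∫ v, C * (2 * ‖pt v‖) ^ β ∂(gaussLaw d σ)
      = 2 ^ (β / 2 + 1) * C * Real.Gamma (d + β / 2) / Real.Gamma d * σ ^ β := by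
  simp only [Real.mul_rpow zero_le_two (norm_nonneg _)]
  rw [integral_const_mul, integral_const_mul, integral_norm_rpow_gaussLaw hd hσ hβ]
  have e : (2 : ℝ) ^ (β / 2 + 1) = 2 * (2 ^ β * 2 ^ (-(β / 2))) := by
    rw [← Real.rpow_add two_pos, Real.rpow_add_one two_ne_zero]
    ring_nf
  rw [e]
  ring

theorem IsMarginExtension.toReal_hingeRisk_sub_le (hd : 0 < d) {P : Measure (X × Y)}
    [IsProbabilityMeasure P] {κ : Kernel X Y} [IsMarkovKernel κ] [P.IsCondKernel κ]
    {C β r σ : ℝ} (hσ : 0 < σ) (hβ : 0 < β) (h : MarginNoise P κ C β)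
    {F : Feat d × Feat d → ℝ} (hF : IsMarginExtension κ r F) :
    (hingeRisk P fun p => gaussConv σ F (val₂ p)).toReal - (hingeRisk P (bayesRule κ)).toReal
      ≤ 2 ^ (β / 2 + 1) * C * Real.Gamma (d + β / 2) / Real.Gamma d * σ ^ β := by
  have := isProbabilityMeasure_gaussLaw (d := d) hσ
  have hm : Measurable fun p : X × X => gaussConv σ F (val₂ p) :=
    (measurable_gaussConv hσ hF.measurable).comp (by unfold val₂; fun_prop)
  have h1 : ∀ p : X × X, |gaussConv σ F (val₂ p)| ≤ 1 := fun p =>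
    abs_gaussConv_le_one hσ hF.abs_le_one _
  rw [toReal_hingeRisk_sub_bayesRule P κ hm h1, ← integral_const_mul_rpow_gaussLaw hd hσ hβ]
  refine le_trans ?_ (mul_le_mul_of_nonneg_left
    (integral_abs_eta_mul_gaussLaw_le hd hσ hβ h) zero_le_two)
  rw [← integral_const_mul]
  have hE : MeasurableSet {z : (X × X) × (Feat d × Feat d) |
      boundaryDist κ z.1 ≤ 2 * ‖pt z.2‖} :=
    measurableSet_le ((measurable_boundaryDist κ).comp measurable_fst)
      ((continuous_pt.norm.measurable.comp measurable_snd).const_mul 2)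
  refine integral_mono ?_ ?_ fun p => ?_
  · have hb := integrable_eta_mul (P.fst.prod P.fst) κ (measurable_bayesRule κ)
      fun p => abs_realSign_le_one _
    refine (hb.sub (integrable_eta_mul (P.fst.prod P.fst) κ hm h1)).congr
      (Filter.Eventually.of_forall fun p => ?_)
    simp only [Pi.sub_apply, mul_sub]
  · refine ((integrable_abs_eta (P.fst.prod P.fst) κ).mul_bdd (c := 1)
      (measurable_measure_prodMk_left hE).ennreal_toReal.aestronglyMeasurable
      (Filter.Eventually.of_forall fun p => ?_)).const_mul 2
    rw [Real.norm_of_nonneg ENNReal.toReal_nonneg]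
    exact measureReal_le_one
  · calc (etaPos κ p - etaNeg κ p) * (bayesRule κ p - gaussConv σ F (val₂ p))
        ≤ |etaPos κ p - etaNeg κ p| * |bayesRule κ p - gaussConv σ F (val₂ p)| := by
          rw [← abs_mul]; exact le_abs_self _
      _ ≤ |etaPos κ p - etaNeg κ p| *
          (2 * (gaussLaw d σ).real {v | boundaryDist κ p ≤ 2 * ‖pt v‖}) := by
          gcongr
          exact hF.abs_bayesRule_sub_gaussConv_le hσ p
      _ = _ := by ring

end Approximation

end PairwiseRanking

/-! ### The approximation bound. -/

theorem mainTheorem6 {d : ℕ} (hd : 0 < d)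
    (X : Set (PairwiseRanking.Feat d)) (hX : IsCompact X) (Y : Set ℝ)
    (P : Measure (X × Y)) [IsProbabilityMeasure P]
    (κ : Kernel X Y) [IsMarkovKernel κ] [P.IsCondKernel κ]
    (r : ℝ) (hr : 0 < r)
    (hXr : ∀ p : X × X, ‖PairwiseRanking.pt (PairwiseRanking.val₂ p)‖ ≤ r)
    (C β : ℝ) (hC : 0 < C) (hβ : 0 < β) (hmargin : PairwiseRanking.MarginNoise P κ C β) :
    PairwiseRanking.IsHingeBayes P (PairwiseRanking.bayesRule κ) ∧
    ∃ F : PairwiseRanking.Feat d × PairwiseRanking.Feat d → ℝ,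
      PairwiseRanking.IsMarginExtension κ r F ∧
      ∀ lam : ℝ, 0 < lam → ∀ σ : ℝ, 0 < σ →
        ∃ f₀ : PairwiseRanking.GaussRKHS X σ,
          (∀ p : X × X, f₀ p = PairwiseRanking.gaussConv σ F (PairwiseRanking.val₂ p)) ∧
          (∀ p : X × X, |f₀ p| ≤ 1) ∧
          lam * ‖f₀‖ ^ 2 + (PairwiseRanking.hingeRisk P f₀).toReal
              - (PairwiseRanking.hingeRisk P (PairwiseRanking.bayesRule κ)).toReal
            ≤ 2 ^ (2 * d + 1) * r ^ (2 * d) / Real.Gamma d * (lam / σ ^ (2 * d))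
              + 2 ^ (β / 2 + 1) * C * Real.Gamma (d + β / 2) / Real.Gamma d * σ ^ β := by
  have hF := PairwiseRanking.isMarginExtension_marginExt hX hr hXr κ
  refine ⟨PairwiseRanking.isHingeBayes_bayesRule P κ, PairwiseRanking.marginExt κ, hF, ?_⟩
  intro lam hlam σ hσ
  obtain ⟨f₀, hf₀, hnorm⟩ := PairwiseRanking.exists_gaussRKHS_eq_gaussConv hd X hσ
    (by positivity : 0 ≤ 2 * r) hF.measurable hF.abs_le_one hF.skew hF.support
  refine ⟨f₀, hf₀, fun p => ?_, ?_⟩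
  · rw [hf₀]; exact PairwiseRanking.abs_gaussConv_le_one hσ hF.abs_le_one _
  have hrisk := hF.toReal_hingeRisk_sub_le hd hσ hβ hmargin
  rw [← show (f₀ : X × X → ℝ) = _ from funext hf₀] at hrisk
  have hd1 : (1 : ℝ) ≤ d := by exact_mod_cast hd
  have hG := Real.Gamma_pos_of_pos (by positivity : (0 : ℝ) < d)
  have hreg : lam * ‖f₀‖ ^ 2
      ≤ 2 ^ (2 * d + 1) * r ^ (2 * d) / Real.Gamma d * (lam / σ ^ (2 * d)) := by
    calc lam * ‖f₀‖ ^ 2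
        ≤ lam * ((2 * r) ^ (2 * d) / (Real.Gamma (d + 1) * σ ^ (2 * d))) := by gcongr
      -- Here `Γ(d+1) = d Γ(d) ≥ Γ(d)`; the stated constant is weaker than the bound obtained by the
      -- factor `2d`.
      _ ≤ lam * ((2 * r) ^ (2 * d) * 2 / (Real.Gamma d * σ ^ (2 * d))) := by
          rw [Real.Gamma_add_one (by positivity)]
          gcongr
          · exact le_mul_of_one_le_right (by positivity) one_le_two
          · exact le_mul_of_one_le_left hG.le hd1
      _ = _ := by rw [mul_pow, pow_succ]; field_simp
  linarith
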